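/- Let $\mathcal X\subseteq\mathbb R^d$ be Borel (more generally, a standard Borel space), $k\ge 1$ and $1\le\Lambda<\infty$. For a law $Q$ of $(Y(1),Y(0),X,A,U)$ on $\mathbb R^2\times\mathcal X\times\{0,1\}\times\mathbb R^k$, with $Y=AY(1)+(1-A)Y(0)$, say that $Q$ satisfies the marginal sensitivity model MSM$(\Lambda)$ if $(Y(1),Y(0))\perp\!\!\!\perp A\mid (X,U)$ under $Q$ and, $Q$-almost surely (all scores being in $(0,1)$), $$\frac1\Lambda\le\frac{Q(A=1\mid X,U)/Q(A=0\mid X,U)}{Q(A=1\mid X)/Q(A=0\mid X)}\le\Lambda .$$ Let $P_o$ satisfy MSM$(\Lambda)$ with $\mathbb E_{P_o}|Y(1)|+\mathbb E_{P_o}|Y(0)|<\infty$, let $P$ be the law of $(X,Y,A)$ under $P_o$, and let $\mathcal P(\Lambda)$ be the set of all $Q$ that satisfy MSM$(\Lambda)$ and under which $(X,Y,A)$ has law $P$. Under $P$ let $e_a(x)=\mathbb P(A=a\mid X=x)$, let $F(\cdot\mid x,a)$ be the distribution function of $Y$ given $X=x,A=a$, and put $$q^+_\Lambda(x,a)=\inf\Big\{q:F(q\mid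 x,a)\ge\tfrac{\Lambda}{1+\Lambda}\Big\},\qquad q^-_\Lambda(x,a)=\inf\Big\{q:F(q\mid x,a)\ge\tfrac{1}{1+\Lambda}\Big\},$$ $$\mu^\pm_\Lambda(x,a)=\mathbb E\Big[Y\,\mathbf 1\{A=a\}\Big(1+\frac{1-e_a(X)}{e_a(X)}\Lambda^{\pm\mathrm{sgn}(Y-q^\pm_\Lambda(X,a))}\Big)\,\Big|\,X=x\Big],\qquad \mathrm{sgn}(t)=\begin{cases}1,&t\ge0\\-1,&t<0,\end{cases}$$ and $\tau^-_\Lambda(x)=\mu^-_\Lambda(x,1)-\mu^+_\Lambda(x,0)$. If $\Lambda>1$, assume that the conditional law of $Y$ has no atom at the quantiles that enter $\tau^-_\Lambda$: $P(A=1,\,Y=q^-_\Lambda(X,1))=0$ and $P(A=0,\,Y=q^+_\Lambda(X,0))=0$. Then for every measurable policy $\pi:\mathcal X\to[0,1]$, all expectations below exist and are finite and $$\Delta_\Lambda(\pi):=\inf_{Q\in\mathcal P(\Lambda)}\mathbb E_Q\big[(Y(1)-Y(0))\,\pi(X)\big]=\mathbb E\big[\tau^-_\Lambda(X)\,\pi(X)\big].$$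 Moreover, $\pi^\star(x)=\mathbf 1\{\tau^-_\Lambda(x)>0\}=\mathbf 1\{\mu^-_\Lambda(x,1)-\mu^+_\Lambda(x,0)>0\}$ is a measurable policy that maximizes $\Delta_\Lambda$ over all measurable policies $\mathcal X\to[0,1]$. -/

import Mathlib

open MeasureTheory ProbabilityTheory

namespace MSM

/-- The space `ℝ² × 𝒳 × {0,1} × ℝᵏ` of values of `((Y(1), Y(0)), X, A, U)`. Treatments are coded
by `Bool`, with `true` for `1` and `false` for `0`. -/
abbrev Full (𝒳 : Type*) (k : ℕ) : Type _ := (ℝ × ℝ) × 𝒳 × Bool × (Fin k → ℝ)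

/-- The space of values of the observed data `(X, Y, A)`. -/
abbrev Obs (𝒳 : Type*) : Type _ := 𝒳 × ℝ × Bool

section Coordinates

variable {𝒳 : Type*} {k : ℕ}

/-- Potential outcome under treatment. -/
def Y₁ (o : Full 𝒳 k) : ℝ := o.1.1

/-- Potential outcome under control. -/
def Y₀ (o : Full 𝒳 k) : ℝ := o.1.2

/-- Covariates. -/
def X (o : Full 𝒳 k) : 𝒳 := o.2.1

/-- Treatment. -/
def A (o : Full 𝒳 k) : Bool := o.2.2.1

/-- Unobserved confounders. -/
def U (o : Full 𝒳 k) : Fin k → ℝ := o.2.2.2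

/-- Covariates together with the unobserved confounders. -/
def XU (o : Full 𝒳 k) : 𝒳 × (Fin k → ℝ) := (X o, U o)

/-- The realized outcome `Y = A Y(1) + (1 - A) Y(0)`. -/
def Y (o : Full 𝒳 k) : ℝ := if A o = true then Y₁ o else Y₀ o

/-- The observed part `(X, Y, A)`. -/
def toObs (o : Full 𝒳 k) : Obs 𝒳 := (X o, Y o, A o)

variable [MeasurableSpace 𝒳]

theorem measurable_X : Measurable (X : Full 𝒳 k → 𝒳) := by unfold X; fun_prop

theorem measurable_A : Measurable (A : Full 𝒳 k → Bool) := by unfold A; fun_prop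

theorem measurable_XU : Measurable (XU : Full 𝒳 k → 𝒳 × (Fin k → ℝ)) := by
  unfold XU X U; fun_prop

theorem measurable_Y : Measurable (Y : Full 𝒳 k → ℝ) :=
  Measurable.ite (measurable_A (measurableSet_singleton true))
    (by unfold Y₁; fun_prop) (by unfold Y₀; fun_prop)

theorem measurable_toObs : Measurable (toObs : Full 𝒳 k → Obs 𝒳) :=
  measurable_X.prodMk (measurable_Y.prodMk measurable_A)

end Coordinates

noncomputable section

variable {𝒳 : Type*} [MeasurableSpace 𝒳] {k : ℕ}

/-! ### The marginal sensitivity model -/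

/-- The law of the observed data `(X, Y, A)` when `((Y(1), Y(0)), X, A, U) ∼ Q`. -/
def obsLaw (Q : ProbabilityMeasure (Full 𝒳 k)) : ProbabilityMeasure (Obs 𝒳) :=
  Q.map measurable_toObs.aemeasurable

/-- The propensity score `e_Q(x, u) = Q(A = 1 | X = x, U = u)`. -/
def truePropensity (Q : ProbabilityMeasure (Full 𝒳 k)) (x : 𝒳) (u : Fin k → ℝ) : ℝ :=
  (condDistrib A XU (Q : Measure (Full 𝒳 k)) (x, u)).real {true}

/-- The nominal propensity score `Q(A = 1 | X = x)`. -/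
def nominalPropensity (Q : ProbabilityMeasure (Full 𝒳 k)) (x : 𝒳) : ℝ :=
  (condDistrib A X (Q : Measure (Full 𝒳 k)) x).real {true}

/-- The odds `p / (1 - p)` of a probability `p`. -/
def odds (p : ℝ) : ℝ := p / (1 - p)

/-- The selection bias condition: the ratio of the odds of the true and of the nominal propensity
score lies in `[1/Λ, Λ]` almost surely. The ratio only makes sense if both scores lie in `(0, 1)`,
and the lower bound enforces this: if a score is `0` or `1`, the left-hand quotient is `0` by the
convention for division by zero, hence less than `1/Λ`. -/
def OddsRatioBounded (Λ : ℝ) (Q : ProbabilityMeasure (Full 𝒳 k)) : Prop :=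
  ∀ᵐ o ∂(Q : Measure (Full 𝒳 k)),
    1 / Λ ≤ odds (truePropensity Q (X o) (U o)) / odds (nominalPropensity Q (X o)) ∧
      odds (truePropensity Q (X o) (U o)) / odds (nominalPropensity Q (X o)) ≤ Λ

/-- Latent unconfoundedness: `(Y(1), Y(0)) ⫫ A ∣ (X, U)` under `Q`. -/
def LatentUnconfounded [StandardBorelSpace 𝒳] (Q : ProbabilityMeasure (Full 𝒳 k)) : Prop :=
  CondIndepFun (MeasurableSpace.comap (XU : Full 𝒳 k → 𝒳 × (Fin k → ℝ)) inferInstance)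
    measurable_XU.comap_le (fun o : Full 𝒳 k => (Y₁ o, Y₀ o)) A (Q : Measure (Full 𝒳 k))

/-- The marginal sensitivity model with parameter `Λ`. -/
structure IsMSM [StandardBorelSpace 𝒳] (Λ : ℝ) (Q : ProbabilityMeasure (Full 𝒳 k)) : Prop where
  latentUnconfounded : LatentUnconfounded Q
  oddsRatioBounded : OddsRatioBounded Λ Q

/-- The uncertainty set `𝒫(Λ)`: all laws of `((Y(1), Y(0)), X, A, U)` with `U ∈ ℝᵏ` that satisfy
the marginal sensitivity model and are compatible with the observed-data law `P`. -/
def uncertaintySet [StandardBorelSpace 𝒳] (k : ℕ) (Λ : ℝ) (P : ProbabilityMeasure (Obs 𝒳)) :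
    Set (ProbabilityMeasure (Full 𝒳 k)) :=
  {Q | LatentUnconfounded Q ∧ obsLaw Q = P ∧ OddsRatioBounded Λ Q}

/-! ### Quantities of the observed-data law -/

/-- `e_a(x) = P(A = a | X = x)`. -/
def propensity (P : ProbabilityMeasure (Obs 𝒳)) (a : Bool) (x : 𝒳) : ℝ :=
  (condDistrib (fun z : Obs 𝒳 => z.2.2) (fun z : Obs 𝒳 => z.1) (P : Measure (Obs 𝒳)) x).real {a}

/-- The conditional distribution function `F(q | x, a)` of `Y` given `X = x` and `A = a`. -/
def outcomeCDF (P : ProbabilityMeasure (Obs 𝒳)) (q : ℝ) (x : 𝒳) (a : Bool) : ℝ :=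
  (condDistrib (fun z : Obs 𝒳 => z.2.1) (fun z : Obs 𝒳 => (z.1, z.2.2))
    (P : Measure (Obs 𝒳)) (x, a)).real (Set.Iic q)

/-- The upper quantile `q⁺_Λ(x, a)`. -/
def qPlus (P : ProbabilityMeasure (Obs 𝒳)) (Λ : ℝ) (x : 𝒳) (a : Bool) : ℝ :=
  sInf {q : ℝ | Λ / (1 + Λ) ≤ outcomeCDF P q x a}

/-- The lower quantile `q⁻_Λ(x, a)`. -/
def qMinus (P : ProbabilityMeasure (Obs 𝒳)) (Λ : ℝ) (x : 𝒳) (a : Bool) : ℝ :=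
  sInf {q : ℝ | 1 / (1 + Λ) ≤ outcomeCDF P q x a}

/-- The sign function with `sgn 0 = 1`. -/
def sgn (t : ℝ) : ℤ := if 0 ≤ t then 1 else -1

/-- The conditional law of `(Y, A)` given `X = x`. -/
def condLawYA (P : ProbabilityMeasure (Obs 𝒳)) (x : 𝒳) : Measure (ℝ × Bool) :=
  condDistrib (fun z : Obs 𝒳 => z.2) (fun z : Obs 𝒳 => z.1) (P : Measure (Obs 𝒳)) x

/-- `μ⁺_Λ(x, a) = E[Y 1{A = a} (1 + (1 - e_a(X)) / e_a(X) * Λ ^ (sgn (Y - q⁺_Λ(X, a)))) | X = x]`. -/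
def muPlus (P : ProbabilityMeasure (Obs 𝒳)) (Λ : ℝ) (x : 𝒳) (a : Bool) : ℝ :=
  ∫ w : ℝ × Bool, w.1 * (if w.2 = a then 1 else 0) *
    (1 + (1 - propensity P a x) / propensity P a x * Λ ^ (sgn (w.1 - qPlus P Λ x a)))
    ∂(condLawYA P x)

/-- `μ⁻_Λ(x, a) = E[Y 1{A = a} (1 + (1 - e_a(X)) / e_a(X) * Λ ^ (-sgn (Y - q⁻_Λ(X, a)))) | X = x]`. -/
def muMinus (P : ProbabilityMeasure (Obs 𝒳)) (Λ : ℝ) (x : 𝒳) (a : Bool) : ℝ :=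
  ∫ w : ℝ × Bool, w.1 * (if w.2 = a then 1 else 0) *
    (1 + (1 - propensity P a x) / propensity P a x * Λ ^ (-sgn (w.1 - qMinus P Λ x a)))
    ∂(condLawYA P x)

/-- `τ⁻_Λ(x) = μ⁻_Λ(x, 1) - μ⁺_Λ(x, 0)`. -/
def tauMinus (P : ProbabilityMeasure (Obs 𝒳)) (Λ : ℝ) (x : 𝒳) : ℝ :=
  muMinus P Λ x true - muPlus P Λ x false

/-! ### Policies and the worst-case policy improvement -/

variable (𝒳) in
/-- The set `Π_o` of all (possibly randomized) measurable policies `𝒳 → [0, 1]`. -/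
def policies : Set (𝒳 → ℝ) := {π | Measurable π ∧ ∀ x, π x ∈ Set.Icc (0 : ℝ) 1}

/-- The policy improvement `E_Q[(Y(1) - Y(0)) π(X)]`. -/
def improvement (Q : ProbabilityMeasure (Full 𝒳 k)) (π : 𝒳 → ℝ) : ℝ :=
  ∫ o, (Y₁ o - Y₀ o) * π (X o) ∂(Q : Measure (Full 𝒳 k))

/-- The worst-case policy improvement `Δ_Λ(π) = inf_{Q ∈ 𝒫(Λ)} E_Q[(Y(1) - Y(0)) π(X)]`. -/
def worstCaseImprovement [StandardBorelSpace 𝒳] (k : ℕ) (Λ : ℝ) (P : ProbabilityMeasure (Obs 𝒳))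
    (π : 𝒳 → ℝ) : ℝ :=
  sInf ((fun Q => improvement Q π) '' uncertaintySet k Λ P)

open Classical in
/-- The policy `x ↦ 1{τ⁻_Λ(x) > 0}`. -/
def firstBestPolicy (P : ProbabilityMeasure (Obs 𝒳)) (Λ : ℝ) (x : 𝒳) : ℝ :=
  if 0 < tauMinus P Λ x then 1 else 0

end

end MSM

open MSM

/-! ### Inverse probability weighting on an abstract probability space. -/

section InverseWeighting

open scoped ENNReal

variable {Ω γ β : Type*} [MeasurableSpace Ω] [MeasurableSpace γ] [MeasurableSpace β]
  {μ : Measure Ω} [IsProbabilityMeasure μ] {T : Ω → Bool} {K : Ω → γ} {G : Ω → β}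
  {η : Kernel γ Bool} [IsMarkovKernel η]

/-! Write `e` for the nominal propensity of arm `a`, `r = (1 - e) / e`, and `W = 1{A = a} / Q(A = a
| X, U)`. Latent unconfoundedness gives `E_Q[φ(X, Y(a))] = E_Q[W φ(X, Y)]` (`ipw_identity`), and the
odds ratio bound confines `W` on `{A = a}` to the band `[1 + r / Λ, 1 + r Λ]` (`ipw_bounds`). The
band depends only on `P`, so the problem becomes the minimization of a linear functional of the
weight.

Lower bound. Every law in the uncertainty set gives the same value to `E_Q[q(X) g(X)]`, so a cutoff
`q(X)` can be subtracted from the outcome without changing the comparison between two laws. After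
that the minimum over the band is pointwise: for arm 1 the smallest weight where `Y ≥ q` and the
largest where `Y < q`, for arm 0 the opposite (`extremalWeight_le`, `IsExtremal.le`).

Attainment. A single law must realize the extremal weights of both arms. Let `U` encode the label `L
= 1{Y ≥ cutoff of the own arm}`. Without atoms at the cutoffs, `P(L = 1 | X, A)` is `Λ / (1 + Λ)` in
arm 1 and `1 / (1 + Λ)` in arm 0, so the likelihood ratio of `L` between the arms is `Λ` or `1 / Λ`.
By Bayes' rule this is the odds ratio, and the inverse propensities are exactly the extremal weights
(`exists_label`, `condDistrib_label`, `exists_extremal_law`). Drawing the two potential outcomes and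
the treatment independently given `(X, U)` makes the law unconfounded and preserves the law of the
observed data and `U` (`exists_latentUnconfounded`).

The minimizing law does not depend on the policy. Disintegrating its objective over `X` gives
`E[τ⁻(X) π(X)]`, which is maximized pointwise by `1{τ⁻ > 0}`. -/

theorem lintegral_inverse_weight (hT : Measurable T) (hK : Measurable K) (hG : Measurable G)
    (h : μ.map (fun ω => ((K ω, G ω), T ω)) =
      μ.map (fun ω => (K ω, G ω)) ⊗ₘ η.prodMkRight β)
    (a : Bool) (hpos : ∀ᵐ ω ∂μ, η (K ω) {a} ≠ 0) {F : γ × β → ℝ≥0∞} (hF : Measurable F) :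
    ∫⁻ ω, (if T ω = a then (η (K ω) {a})⁻¹ else 0) * F (K ω, G ω) ∂μ =
      ∫⁻ ω, F (K ω, G ω) ∂μ := by
  have hm : Measurable fun p : γ × β => (η p.1 {a})⁻¹ * F p :=
    ((η.measurable_coe (measurableSet_singleton a)).comp measurable_fst).inv.mul hF
  have hm' : Measurable fun p : (γ × β) × Bool =>
      (if p.2 = a then 1 else 0) * ((η p.1.1 {a})⁻¹ * F p.1) :=
    (Measurable.ite (measurable_snd (measurableSet_singleton a)) measurable_const
      measurable_const).mul (hm.comp measurable_fst)
  calc ∫⁻ ω, (if T ω = a then (η (K ω) {a})⁻¹ else 0) * F (K ω, G ω) ∂μ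
      = ∫⁻ p, (if p.2 = a then 1 else 0) * ((η p.1.1 {a})⁻¹ * F p.1)
          ∂(μ.map (fun ω => ((K ω, G ω), T ω))) := by
        rw [lintegral_map hm' (by fun_prop)]
        refine lintegral_congr fun ω => ?_
        dsimp only
        split_ifs <;> simp
    _ = ∫⁻ p, F p ∂(μ.map (fun ω => (K ω, G ω))) := by
        rw [h, Measure.lintegral_compProd hm']
        refine lintegral_congr_ae ?_
        rw [Filter.EventuallyEq, ae_map_iff (by fun_prop)]
        · filter_upwards [hpos] with ω hω
          rw [lintegral_mul_const'']
          · have : (fun b : Bool => if b = a then (1 : ℝ≥0∞) else 0) =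
              ({a} : Set Bool).indicator 1 := by
              ext b; simp [Set.indicator_apply]
            simp only [Kernel.prodMkRight_apply]
            rw [this, lintegral_indicator_one (measurableSet_singleton a), ← mul_assoc,
              ENNReal.mul_inv_cancel hω (measure_ne_top _ _), one_mul]
          · exact (measurable_of_countable _).aemeasurable
        · exact measurableSet_eq_fun
            (Measurable.lintegral_kernel_prod_right' hm') hF
    _ = ∫⁻ ω, F (K ω, G ω) ∂μ := lintegral_map hF (by fun_prop)

/-- Phrased as an equality of measures, so that integrability and integrals of signed functions
follow together from the nonnegative case. -/
theorem map_withDensity_inverse_weight (hT : Measurable T) (hK : Measurable K) (hG : Measurable G)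
    (h : μ.map (fun ω => ((K ω, G ω), T ω)) =
      μ.map (fun ω => (K ω, G ω)) ⊗ₘ η.prodMkRight β)
    (a : Bool) (hpos : ∀ᵐ ω ∂μ, η (K ω) {a} ≠ 0) :
    (μ.withDensity fun ω => if T ω = a then (η (K ω) {a})⁻¹ else 0).map (fun ω => (K ω, G ω)) =
      μ.map (fun ω => (K ω, G ω)) := by
  have hKG : Measurable fun ω => (K ω, G ω) := by fun_prop
  have hw : Measurable fun ω => if T ω = a then (η (K ω) {a})⁻¹ else 0 :=
    Measurable.ite (hT (measurableSet_singleton a))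
      ((η.measurable_coe (measurableSet_singleton a)).comp hK).inv measurable_const
  ext s hs
  rw [Measure.map_apply hKG hs, Measure.map_apply hKG hs, withDensity_apply _ (hKG hs),
    ← lintegral_indicator (hKG hs), ← lintegral_indicator_one (hKG hs)]
  have := lintegral_inverse_weight hT hK hG h a hpos (F := s.indicator 1)
    (measurable_const.indicator hs)
  convert this using 2
  · ext ω
    by_cases hω : (K ω, G ω) ∈ s <;> simp [hω]
  · rfl

theorem inverse_weight_real (hT : Measurable T) (hK : Measurable K) (hG : Measurable G)
    (h : μ.map (fun ω => ((K ω, G ω), T ω)) =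
      μ.map (fun ω => (K ω, G ω)) ⊗ₘ η.prodMkRight β)
    (a : Bool) (hpos : ∀ᵐ ω ∂μ, η (K ω) {a} ≠ 0) {F : γ × β → ℝ} (hF : Measurable F) :
    (Integrable (fun ω => (if T ω = a then ((η (K ω)).real {a})⁻¹ else 0) * F (K ω, G ω)) μ ↔
      Integrable (fun ω => F (K ω, G ω)) μ) ∧
    ∫ ω, (if T ω = a then ((η (K ω)).real {a})⁻¹ else 0) * F (K ω, G ω) ∂μ =
      ∫ ω, F (K ω, G ω) ∂μ := by
  have hKG : Measurable fun ω => (K ω, G ω) := by fun_prop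
  have hw : Measurable fun ω => if T ω = a then (η (K ω) {a})⁻¹ else 0 :=
    Measurable.ite (hT (measurableSet_singleton a))
      ((η.measurable_coe (measurableSet_singleton a)).comp hK).inv measurable_const
  have hfin : ∀ᵐ ω ∂μ, (if T ω = a then (η (K ω) {a})⁻¹ else 0) < ∞ := by
    filter_upwards [hpos] with ω hω
    split_ifs
    · exact ENNReal.inv_lt_top.2 (pos_iff_ne_zero.2 hω)
    · simp
  have hreal : ∀ ω, (if T ω = a then (η (K ω) {a})⁻¹ else 0).toReal =
      if T ω = a then ((η (K ω)).real {a})⁻¹ else 0 := by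
    intro ω
    split_ifs
    · simp [Measure.real]
    · simp
  have hmap := map_withDensity_inverse_weight hT hK hG h a hpos
  constructor
  · have h1 := integrable_withDensity_iff_integrable_smul' (μ := μ) hw hfin
      (g := fun ω => F (K ω, G ω))
    simp only [hreal, smul_eq_mul] at h1
    rw [← h1]
    have h2 := integrable_map_measure (μ := μ) (f := fun ω => (K ω, G ω)) (g := F)
      hF.aestronglyMeasurable hKG.aemeasurable
    rw [← hmap, integrable_map_measure hF.aestronglyMeasurable hKG.aemeasurable] at h2
    exact h2
  · have h1 := integral_withDensity_eq_integral_toReal_smul (μ := μ) hw hfin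
      (fun ω => F (K ω, G ω))
    simp only [hreal, smul_eq_mul] at h1
    rw [← h1, ← integral_map hKG.aemeasurable hF.aestronglyMeasurable, hmap,
      integral_map hKG.aemeasurable hF.aestronglyMeasurable]

end InverseWeighting

/-! ### Inverse probability weights in the sensitivity model. -/

namespace MSM

noncomputable section

variable {𝒳 : Type*} {k : ℕ}

/-- The potential outcome `Y(a)`. -/
def arm (a : Bool) (o : Full 𝒳 k) : ℝ := if a = true then Y₁ o else Y₀ o

variable [MeasurableSpace 𝒳]

theorem measurable_Y₁ : Measurable (Y₁ : Full 𝒳 k → ℝ) := by unfold Y₁; fun_prop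

theorem measurable_Y₀ : Measurable (Y₀ : Full 𝒳 k → ℝ) := by unfold Y₀; fun_prop

theorem measurable_U : Measurable (U : Full 𝒳 k → Fin k → ℝ) := by unfold U; fun_prop

theorem measurable_arm (a : Bool) : Measurable (arm a : Full 𝒳 k → ℝ) := by
  cases a
  · exact measurable_Y₀
  · exact measurable_Y₁

/-- The inverse probability weight `1{A = a} / Q(A = a | X, U)`. -/
def ipw (Q : ProbabilityMeasure (Full 𝒳 k)) (a : Bool) (o : Full 𝒳 k) : ℝ :=
  if A o = a then ((condDistrib A XU (Q : Measure (Full 𝒳 k)) (XU o)).real {a})⁻¹ else 0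

theorem measurable_ipw (Q : ProbabilityMeasure (Full 𝒳 k)) (a : Bool) : Measurable (ipw Q a) :=
  Measurable.ite (measurable_A (measurableSet_singleton a))
    ((Kernel.measurable_coe _ (measurableSet_singleton a)).comp measurable_XU).ennreal_toReal.inv
    measurable_const

/-- The kernel form serves twice: it is the hypothesis of the weighting identity, and it holds by
construction for the extremal law. -/
theorem latentUnconfounded_iff [StandardBorelSpace 𝒳] (Q : ProbabilityMeasure (Full 𝒳 k)) :
    LatentUnconfounded Q ↔
      (Q : Measure (Full 𝒳 k)).map (fun o => ((XU o, (Y₁ o, Y₀ o)), A o)) =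
        (Q : Measure (Full 𝒳 k)).map (fun o => (XU o, (Y₁ o, Y₀ o))) ⊗ₘ
          (condDistrib A XU (Q : Measure (Full 𝒳 k))).prodMkRight (ℝ × ℝ) := by
  have hY : Measurable fun o : Full 𝒳 k => (Y₁ o, Y₀ o) := measurable_Y₁.prodMk measurable_Y₀
  rw [LatentUnconfounded,
    condIndepFun_iff_condDistrib_prod_ae_eq_prodMkRight measurable_A hY measurable_XU,
    condDistrib_ae_eq_iff_measure_eq_compProd _ measurable_A.aemeasurable]

theorem ipw_identity [StandardBorelSpace 𝒳] {Q : ProbabilityMeasure (Full 𝒳 k)}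
    (hQ : LatentUnconfounded Q) (a : Bool)
    (hpos : ∀ᵐ o ∂(Q : Measure (Full 𝒳 k)),
      (condDistrib A XU (Q : Measure (Full 𝒳 k)) (XU o)).real {a} ≠ 0)
    {φ : 𝒳 × ℝ → ℝ} (hφ : Measurable φ) :
    (Integrable (fun o => ipw Q a o * φ (X o, Y o)) (Q : Measure (Full 𝒳 k)) ↔
      Integrable (fun o => φ (X o, arm a o)) (Q : Measure (Full 𝒳 k))) ∧
    ∫ o, ipw Q a o * φ (X o, Y o) ∂(Q : Measure (Full 𝒳 k)) =
      ∫ o, φ (X o, arm a o) ∂(Q : Measure (Full 𝒳 k)) := by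
  have hY : Measurable fun o : Full 𝒳 k => (Y₁ o, Y₀ o) := measurable_Y₁.prodMk measurable_Y₀
  have hF : Measurable fun p : (𝒳 × (Fin k → ℝ)) × (ℝ × ℝ) =>
      φ (p.1.1, if a = true then p.2.1 else p.2.2) := by
    cases a <;> simp <;> fun_prop
  have key := inverse_weight_real measurable_A measurable_XU hY ((latentUnconfounded_iff Q).1 hQ) a
    (by
      filter_upwards [hpos] with o ho h0
      exact ho (by simp [Measure.real, h0])) hF
  -- On `{A = a}` the realized outcome is `Y(a)`; elsewhere the weight vanishes.
  have e : ∀ o : Full 𝒳 k, ipw Q a o * φ (X o, Y o) =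
      (if A o = a then ((condDistrib A XU (Q : Measure (Full 𝒳 k)) (XU o)).real {a})⁻¹ else 0) *
        φ ((XU o).1, if a = true then Y₁ o else Y₀ o) := by
    intro o
    rw [ipw]
    split_ifs with h1 h2 h2
    · simp [XU, Y, h1, h2]
    · simp [XU, Y, h1, h2]
    · simp
    · simp
  simp only [e]
  exact key

/-- With `r` the odds ratio, `1 / p = 1 + (1 - e) / e * r⁻¹` and `1 / (1 - p) = 1 + e / (1 - e) *
r`, both monotone in `r`. -/
theorem odds_ratio_bounds {Λ p e : ℝ} (hΛ : 1 ≤ Λ) (hp0 : 0 ≤ p) (hp1 : p ≤ 1) (he0 : 0 ≤ e)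
    (he1 : e ≤ 1) (h1 : 1 / Λ ≤ odds p / odds e) (h2 : odds p / odds e ≤ Λ) :
    0 < p ∧ p < 1 ∧ 0 < e ∧ e < 1 ∧
      (1 + (1 - e) / e * Λ⁻¹ ≤ p⁻¹ ∧ p⁻¹ ≤ 1 + (1 - e) / e * Λ) ∧
      (1 + e / (1 - e) * Λ⁻¹ ≤ (1 - p)⁻¹ ∧ (1 - p)⁻¹ ≤ 1 + e / (1 - e) * Λ) := by
  have hΛ0 : 0 < Λ := by linarith
  -- A degenerate score would make this quotient `0` under the convention for division by zero.
  have hpos : 0 < odds p / odds e := lt_of_lt_of_le (by positivity) h1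
  have hp : p ≠ 0 := by rintro rfl; simp [odds] at hpos
  have hp' : p ≠ 1 := by rintro rfl; simp [odds] at hpos
  have he : e ≠ 0 := by rintro rfl; simp [odds] at hpos
  have he' : e ≠ 1 := by rintro rfl; simp [odds] at hpos
  have a1 : 0 < p := lt_of_le_of_ne hp0 hp.symm
  have a2 : 0 < 1 - p := sub_pos.2 (lt_of_le_of_ne hp1 hp')
  have a3 : 0 < e := lt_of_le_of_ne he0 he.symm
  have a4 : 0 < 1 - e := sub_pos.2 (lt_of_le_of_ne he1 he')
  obtain ⟨r, hr⟩ : ∃ r, r = odds p / odds e := ⟨_, rfl⟩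
  rw [← hr] at h1 h2 hpos
  have hr1 : Λ⁻¹ ≤ r := by simpa using h1
  have hrinv : r⁻¹ ≤ Λ := by simpa using inv_anti₀ (inv_pos.2 hΛ0) hr1
  have hrinv' : Λ⁻¹ ≤ r⁻¹ := inv_anti₀ hpos h2
  have e1 : p⁻¹ = 1 + (1 - e) / e * r⁻¹ := by
    rw [hr, odds, odds]; field_simp; ring
  have e2 : (1 - p)⁻¹ = 1 + e / (1 - e) * r := by
    rw [hr, odds, odds]; field_simp; ring
  refine ⟨a1, by linarith, a3, by linarith, ⟨?_, ?_⟩, ⟨?_, ?_⟩⟩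
  · rw [e1]; gcongr
  · rw [e1]; gcongr
  · rw [e2]; gcongr
  · rw [e2]; gcongr

theorem real_singleton_not (m : Measure Bool) [IsProbabilityMeasure m] (a : Bool) :
    m.real {!a} = 1 - m.real {a} := by
  have : ({!a} : Set Bool) = {a}ᶜ := by ext b; cases a <;> cases b <;> simp
  rw [this, probReal_compl_eq_one_sub (measurableSet_singleton a)]

theorem condDistrib_A_X (Q : ProbabilityMeasure (Full 𝒳 k)) :
    condDistrib A X (Q : Measure (Full 𝒳 k)) =
      condDistrib (fun z : Obs 𝒳 => z.2.2) (fun z : Obs 𝒳 => z.1)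
        (obsLaw Q : Measure (Obs 𝒳)) := by
  rw [condDistrib, condDistrib]
  congr 1
  rw [obsLaw, ProbabilityMeasure.toMeasure_map, Measure.map_map (by fun_prop) measurable_toObs]
  rfl

theorem propensity_not (P : ProbabilityMeasure (Obs 𝒳)) (a : Bool) (x : 𝒳) :
    propensity P (!a) x = 1 - propensity P a x :=
  real_singleton_not _ a

/-- Arm 0 has the same form as arm 1 because passing to complementary probabilities inverts the odds
ratio and the band is symmetric under `Λ ↔ Λ⁻¹`. -/
theorem ipw_bounds {Λ : ℝ} (hΛ : 1 ≤ Λ) {Q : ProbabilityMeasure (Full 𝒳 k)}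
    {P : ProbabilityMeasure (Obs 𝒳)} (hP : obsLaw Q = P) (hQ : OddsRatioBounded Λ Q) (a : Bool) :
    ∀ᵐ o ∂(Q : Measure (Full 𝒳 k)),
      (condDistrib A XU (Q : Measure (Full 𝒳 k)) (XU o)).real {a} ≠ 0 ∧
      0 < propensity P a (X o) ∧ propensity P a (X o) < 1 ∧
      (A o = a →
        1 + (1 - propensity P a (X o)) / propensity P a (X o) * Λ⁻¹ ≤ ipw Q a o ∧
        ipw Q a o ≤ 1 + (1 - propensity P a (X o)) / propensity P a (X o) * Λ) := by
  filter_upwards [hQ] with o ⟨h1, h2⟩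
  have hn : nominalPropensity Q (X o) = propensity P true (X o) := by
    rw [nominalPropensity, propensity, condDistrib_A_X, hP]
  rw [hn] at h1 h2
  obtain ⟨a1, a2, a3, a4, b1, b2⟩ := odds_ratio_bounds hΛ measureReal_nonneg measureReal_le_one
    measureReal_nonneg measureReal_le_one h1 h2
  have hp : (condDistrib A XU (Q : Measure (Full 𝒳 k)) (XU o)).real {true} =
    truePropensity Q (X o) (U o) := rfl
  cases a with
  | true =>
    refine ⟨a1.ne', a3, a4, fun hA => ?_⟩
    rw [ipw, if_pos hA]
    exact b1
  | false =>
    have hp' := real_singleton_not (condDistrib A XU (Q : Measure (Full 𝒳 k)) (XU o)) true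
    have he' := propensity_not P true (X o)
    simp only [Bool.not_true] at hp' he'
    rw [ipw, hp', he', hp]
    change 0 < propensity P true (X o) at a3
    change propensity P true (X o) < 1 at a4
    change truePropensity Q (X o) (U o) < 1 at a2
    refine ⟨by linarith, by linarith, by linarith, fun hA => ?_⟩
    rw [if_pos hA, sub_sub_cancel]
    exact b2

end

end MSM

/-! ### Quantiles of a law on the line. -/

section Quantile

open Set Filter Topology

variable {m : Measure ℝ} [IsProbabilityMeasure m] {t : ℝ}

/-- Right continuity of the distribution function puts the infimum in the set; `0 < t < 1` makes the
set bounded below and nonempty, so the `sInf` is genuine. -/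
theorem quantile_le_iff (ht0 : 0 < t) (ht1 : t < 1) (y : ℝ) :
    sInf {q : ℝ | t ≤ m.real (Iic q)} ≤ y ↔ t ≤ m.real (Iic y) := by
  simp only [← cdf_eq_real]
  have hne : {q : ℝ | t ≤ cdf m q}.Nonempty :=
    (((tendsto_cdf_atTop m).eventually (lt_mem_nhds ht1)).exists).imp fun q hq => hq.le
  have hbdd : BddBelow {q : ℝ | t ≤ cdf m q} := by
    obtain ⟨b, hb⟩ := ((tendsto_cdf_atBot m).eventually (gt_mem_nhds ht0)).exists
    refine ⟨b, fun q (hq : t ≤ cdf m q) => ?_⟩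
    by_contra hqb
    exact absurd ((monotone_cdf m) (not_le.1 hqb).le) (by linarith)
  refine ⟨fun h => ?_, fun h => csInf_le hbdd h⟩
  refine le_trans ?_ ((monotone_cdf m) h)
  have hright : Tendsto (cdf m) (𝓝[>] sInf {q : ℝ | t ≤ cdf m q})
      (𝓝 (cdf m (sInf {q : ℝ | t ≤ cdf m q}))) :=
    ((cdf m).right_continuous _).mono_left (nhdsWithin_mono _ Ioi_subset_Ici_self)
  refine ge_of_tendsto hright ?_
  filter_upwards [self_mem_nhdsWithin] with z hz
  obtain ⟨s, hs, hsz⟩ := exists_lt_of_csInf_lt hne hz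
  exact le_trans hs ((monotone_cdf m) hsz.le)

/-- The distribution function is below `t` to the left of the quantile and at least `t` at it; the
absence of an atom closes the gap. -/
theorem measure_Iio_quantile (ht0 : 0 < t) (ht1 : t < 1)
    (hatom : m {sInf {q : ℝ | t ≤ m.real (Iic q)}} = 0) :
    m (Iio (sInf {q : ℝ | t ≤ m.real (Iic q)})) = ENNReal.ofReal t := by
  set q := sInf {q : ℝ | t ≤ m.real (Iic q)} with hq
  have hge : t ≤ m.real (Iic q) := (quantile_le_iff ht0 ht1 q).1 le_rfl
  have heq : m (Iic q) = m (Iio q) := by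
    rw [← Iio_union_right]
    refine le_antisymm ((measure_union_le _ _).trans (by rw [hatom, add_zero]))
      (measure_mono subset_union_left)
  refine le_antisymm ?_ ?_
  · have hl : m (Iio q) = ENNReal.ofReal (Function.leftLim (cdf m) q - 0) := by
      conv_lhs => rw [← measure_cdf m]
      exact (cdf m).measure_Iio (tendsto_cdf_atBot m) q
    rw [hl, sub_zero]
    refine ENNReal.ofReal_le_ofReal ?_
    refine le_of_tendsto ((monotone_cdf m).tendsto_leftLim q) ?_
    filter_upwards [self_mem_nhdsWithin] with z hz
    by_contra h
    rw [not_le, cdf_eq_real] at h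
    exact absurd ((quantile_le_iff ht0 ht1 z).2 h.le) (not_le.2 hz)
  · rw [← heq, ← ofReal_measureReal]
    exact ENNReal.ofReal_le_ofReal hge

theorem measure_Ici_quantile (ht0 : 0 < t) (ht1 : t < 1)
    (hatom : m {sInf {q : ℝ | t ≤ m.real (Iic q)}} = 0) :
    m (Ici (sInf {q : ℝ | t ≤ m.real (Iic q)})) = ENNReal.ofReal (1 - t) := by
  rw [← compl_Iio, prob_compl_eq_one_sub measurableSet_Iio, measure_Iio_quantile ht0 ht1 hatom,
    ENNReal.ofReal_sub _ ht0.le, ENNReal.ofReal_one]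

end Quantile

/-! ### Extremal weights and the binary label behind them. -/

namespace MSM

noncomputable section

open scoped ENNReal

variable {𝒳 : Type*} [MeasurableSpace 𝒳]

/-- The probability level of the quantile at which the extremal weight of arm `a` jumps. -/
def cutoffLevel (Λ : ℝ) (a : Bool) : ℝ := if a = true then 1 / (1 + Λ) else Λ / (1 + Λ)

/-- The quantile at which the extremal weight of arm `a` jumps. -/
def cutoff (P : ProbabilityMeasure (Obs 𝒳)) (Λ : ℝ) (a : Bool) (x : 𝒳) : ℝ :=
  if a = true then qMinus P Λ x a else qPlus P Λ x a

/-- The weight `1 + (1 - e_a(x)) / e_a(x) * Λ ^ (∓ sgn (y - q^∓(x, a)))` that minimizes the mean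
of `Y(1)` if `a = 1` and maximizes the mean of `Y(0)` if `a = 0`. -/
def extremalWeight (P : ProbabilityMeasure (Obs 𝒳)) (Λ : ℝ) (a : Bool) (x : 𝒳) (y : ℝ) : ℝ :=
  1 + (1 - propensity P a x) / propensity P a x *
    Λ ^ (if a = true then -sgn (y - cutoff P Λ a x) else sgn (y - cutoff P Λ a x))

theorem cutoffLevel_pos {Λ : ℝ} (hΛ : 1 ≤ Λ) (a : Bool) : 0 < cutoffLevel Λ a := by
  have : 0 < Λ := by linarith
  cases a <;> simp [cutoffLevel] <;> positivity

theorem cutoffLevel_lt_one {Λ : ℝ} (hΛ : 1 ≤ Λ) (a : Bool) : cutoffLevel Λ a < 1 := by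
  have : 0 < Λ := by linarith
  rw [cutoffLevel]
  split_ifs <;> rw [div_lt_one (by positivity)] <;> linarith

theorem cutoff_eq (P : ProbabilityMeasure (Obs 𝒳)) (Λ : ℝ) (a : Bool) (x : 𝒳) :
    cutoff P Λ a x = sInf {q : ℝ | cutoffLevel Λ a ≤
      (condDistrib (fun z : Obs 𝒳 => z.2.1) (fun z : Obs 𝒳 => (z.1, z.2.2))
        (P : Measure (Obs 𝒳)) (x, a)).real (Set.Iic q)} := by
  cases a <;> rfl

/-- By `quantile_le_iff`, the sublevel sets are superlevel sets of a kernel evaluated at a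
half-line. -/
theorem measurable_cutoff (P : ProbabilityMeasure (Obs 𝒳)) {Λ : ℝ} (hΛ : 1 ≤ Λ) (a : Bool) :
    Measurable (cutoff P Λ a) := by
  refine measurable_of_Iic fun t => ?_
  have : cutoff P Λ a ⁻¹' Set.Iic t = {x | cutoffLevel Λ a ≤
      (condDistrib (fun z : Obs 𝒳 => z.2.1) (fun z : Obs 𝒳 => (z.1, z.2.2))
        (P : Measure (Obs 𝒳)) (x, a)).real (Set.Iic t)} := by
    ext x
    rw [Set.mem_preimage, Set.mem_Iic, cutoff_eq,
      quantile_le_iff (cutoffLevel_pos hΛ a) (cutoffLevel_lt_one hΛ a)]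
    rfl
  rw [this]
  exact measurableSet_le measurable_const
    ((Kernel.measurable_coe _ measurableSet_Iic).comp (by fun_prop)).ennreal_toReal

theorem measurable_propensity (P : ProbabilityMeasure (Obs 𝒳)) (a : Bool) :
    Measurable (propensity P a) :=
  (Kernel.measurable_coe _ (measurableSet_singleton a)).ennreal_toReal

theorem measurable_sgn : Measurable sgn :=
  Measurable.ite measurableSet_Ici measurable_const measurable_const

theorem measurable_extremalWeight (P : ProbabilityMeasure (Obs 𝒳)) {Λ : ℝ} (hΛ : 1 ≤ Λ)
    (a : Bool) : Measurable fun p : 𝒳 × ℝ => extremalWeight P Λ a p.1 p.2 := by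
  have h1 : Measurable fun p : 𝒳 × ℝ => sgn (p.2 - cutoff P Λ a p.1) :=
    measurable_sgn.comp (measurable_snd.sub ((measurable_cutoff P hΛ a).comp measurable_fst))
  have h2 : Measurable fun p : 𝒳 × ℝ => propensity P a p.1 :=
    (measurable_propensity P a).comp measurable_fst
  have h3 : Measurable fun p : 𝒳 × ℝ => Λ ^ (if a = true then -sgn (p.2 - cutoff P Λ a p.1)
      else sgn (p.2 - cutoff P Λ a p.1)) := by
    cases a
    · exact (measurable_of_countable (fun n : ℤ => Λ ^ n)).comp h1
    · exact (measurable_of_countable (fun n : ℤ => Λ ^ (-n))).comp h1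
  exact measurable_const.add (((measurable_const.sub h2).div h2).mul h3)

/-- The conditional law of the treatment given the covariates disintegrates `P`. -/
theorem lintegral_treatment (P : ProbabilityMeasure (Obs 𝒳)) (a : Bool) {h : 𝒳 → ℝ≥0∞}
    (hh : Measurable h) :
    ∫⁻ z, (if z.2.2 = a then h z.1 else 0) ∂(P : Measure (Obs 𝒳)) =
      ∫⁻ z, condDistrib (fun z : Obs 𝒳 => z.2.2) (fun z : Obs 𝒳 => z.1)
        (P : Measure (Obs 𝒳)) z.1 {a} * h z.1 ∂(P : Measure (Obs 𝒳)) := by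
  have hm : Measurable fun p : 𝒳 × Bool => if p.2 = a then h p.1 else 0 :=
    Measurable.ite (measurable_snd (measurableSet_singleton a)) (hh.comp measurable_fst)
      measurable_const
  have h1 : (P : Measure (Obs 𝒳)).map (fun z : Obs 𝒳 => z.1) ⊗ₘ
      condDistrib (fun z : Obs 𝒳 => z.2.2) (fun z : Obs 𝒳 => z.1) (P : Measure (Obs 𝒳)) =
      (P : Measure (Obs 𝒳)).map (fun z : Obs 𝒳 => (z.1, z.2.2)) :=
    compProd_map_condDistrib (by fun_prop)
  have h2 := lintegral_map (μ := (P : Measure (Obs 𝒳))) hm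
    (g := fun z : Obs 𝒳 => (z.1, z.2.2)) (by fun_prop)
  rw [← h2, ← h1, Measure.lintegral_compProd hm, lintegral_map _ (by fun_prop)]
  · refine lintegral_congr fun z => ?_
    have : (fun b : Bool => if b = a then h z.1 else 0) =
        ({a} : Set Bool).indicator fun _ => h z.1 := by
      ext b; simp [Set.indicator_apply]
    simp only [this]
    rw [lintegral_indicator_const (measurableSet_singleton a), mul_comm]
  · exact Measurable.lintegral_kernel_prod_right' hm

/-- Inside an arm, the probability that the outcome is above the cutoff does not depend on the
covariates. -/
theorem lintegral_cutoff (P : ProbabilityMeasure (Obs 𝒳)) {Λ : ℝ} (hΛ : 1 ≤ Λ) (a u : Bool)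
    (hq : ∀ᵐ z ∂(P : Measure (Obs 𝒳)), ¬ (z.2.2 = a ∧ z.2.1 = cutoff P Λ a z.1))
    {h : 𝒳 → ℝ≥0∞} (hh : Measurable h) :
    ∫⁻ z, (if z.2.2 = a ∧ decide (cutoff P Λ z.2.2 z.1 ≤ z.2.1) = u then h z.1 else 0)
        ∂(P : Measure (Obs 𝒳)) =
      ENNReal.ofReal (if u = true then 1 - cutoffLevel Λ a else cutoffLevel Λ a) *
        ∫⁻ z, (if z.2.2 = a then h z.1 else 0) ∂(P : Measure (Obs 𝒳)) := by
  set κ := condDistrib (fun z : Obs 𝒳 => z.2.1) (fun z : Obs 𝒳 => (z.1, z.2.2))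
    (P : Measure (Obs 𝒳)) with hκ
  have hdis : (P : Measure (Obs 𝒳)).map (fun z : Obs 𝒳 => (z.1, z.2.2)) ⊗ₘ κ =
      (P : Measure (Obs 𝒳)).map (fun z : Obs 𝒳 => ((z.1, z.2.2), z.2.1)) :=
    compProd_map_condDistrib (by fun_prop)
  have hc := measurable_cutoff P hΛ a
  have hSet : MeasurableSet {p : (𝒳 × Bool) × ℝ |
      p.1.2 = a ∧ decide (cutoff P Λ a p.1.1 ≤ p.2) = u} := by
    refine (measurableSet_eq_fun (by fun_prop) measurable_const).inter ?_
    cases u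
    · simp only [decide_eq_false_iff_not]
      exact (measurableSet_le (hc.comp (by fun_prop)) measurable_snd).compl
    · simp only [decide_eq_true_eq]
      exact measurableSet_le (hc.comp (by fun_prop)) measurable_snd
  have hm : Measurable fun p : (𝒳 × Bool) × ℝ =>
      if p.1.2 = a ∧ decide (cutoff P Λ a p.1.1 ≤ p.2) = u then h p.1.1 else 0 :=
    Measurable.ite hSet (hh.comp (by fun_prop)) measurable_const
  have hm2 : Measurable fun p : 𝒳 × Bool => if p.2 = a then h p.1 else 0 :=
    Measurable.ite (measurable_snd (measurableSet_singleton a)) (hh.comp measurable_fst)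
      measurable_const
  -- Disintegration turns the joint almost sure statement into the absence of a conditional atom at
  -- almost every `(x, a)`.
  have hatom : ∀ᵐ p ∂((P : Measure (Obs 𝒳)).map (fun z : Obs 𝒳 => (z.1, z.2.2))),
      p.2 = a → κ p {cutoff P Λ a p.1} = 0 := by
    have h1 : ∀ᵐ p ∂((P : Measure (Obs 𝒳)).map (fun z : Obs 𝒳 => (z.1, z.2.2)) ⊗ₘ κ),
        ¬ (p.1.2 = a ∧ p.2 = cutoff P Λ a p.1.1) := by
      rw [hdis, ae_map_iff (by fun_prop)]
      · exact hq
      · exact ((measurableSet_eq_fun (by fun_prop) measurable_const).inter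
          (measurableSet_eq_fun measurable_snd (hc.comp (by fun_prop)))).compl
    filter_upwards [Measure.ae_ae_of_ae_compProd h1] with p hp hpa
    rw [ae_iff] at hp
    convert hp using 2
    ext y
    simp [hpa]
  calc ∫⁻ z, (if z.2.2 = a ∧ decide (cutoff P Λ z.2.2 z.1 ≤ z.2.1) = u then h z.1 else 0)
        ∂(P : Measure (Obs 𝒳))
      = ∫⁻ p, (if p.1.2 = a ∧ decide (cutoff P Λ a p.1.1 ≤ p.2) = u then h p.1.1 else 0)
          ∂((P : Measure (Obs 𝒳)).map (fun z : Obs 𝒳 => ((z.1, z.2.2), z.2.1))) := by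
        rw [lintegral_map hm (by fun_prop)]
        refine lintegral_congr fun z => ?_
        by_cases hz : z.2.2 = a
        · simp only [hz]
        · simp only [hz, false_and]
    _ = ∫⁻ p, ENNReal.ofReal (if u = true then 1 - cutoffLevel Λ a else cutoffLevel Λ a) *
          (if p.2 = a then h p.1 else 0)
          ∂((P : Measure (Obs 𝒳)).map (fun z : Obs 𝒳 => (z.1, z.2.2))) := by
        rw [← hdis, Measure.lintegral_compProd hm]
        refine lintegral_congr_ae ?_
        filter_upwards [hatom] with p hp
        by_cases hpa : p.2 = a
        · specialize hp hpa
          obtain ⟨x, b⟩ := p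
          change b = a at hpa
          subst hpa
          simp only [true_and, if_true]
          rw [cutoff_eq, ← hκ] at hp
          have hS : ∀ S : Set ℝ, MeasurableSet S → (∀ y, decide (cutoff P Λ b x ≤ y) = u ↔ y ∈ S) →
              ∫⁻ y, (if decide (cutoff P Λ b x ≤ y) = u then h x else 0) ∂(κ (x, b)) =
                κ (x, b) S * h x := by
            intro S hS hSu
            have : (fun y => if decide (cutoff P Λ b x ≤ y) = u then h x else 0) =
                S.indicator fun _ => h x := by
              ext y
              by_cases hy : y ∈ S
              · rw [if_pos ((hSu y).2 hy), Set.indicator_of_mem hy]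
              · rw [if_neg (mt (hSu y).1 hy), Set.indicator_of_notMem hy]
            rw [this, lintegral_indicator_const hS, mul_comm]
          cases u with
          | true =>
            rw [hS (Set.Ici (cutoff P Λ b x)) measurableSet_Ici (by simp), cutoff_eq, ← hκ,
              measure_Ici_quantile (cutoffLevel_pos hΛ b) (cutoffLevel_lt_one hΛ b) hp]
            simp
          | false =>
            rw [hS (Set.Iio (cutoff P Λ b x)) measurableSet_Iio (by simp), cutoff_eq, ← hκ,
              measure_Iio_quantile (cutoffLevel_pos hΛ b) (cutoffLevel_lt_one hΛ b) hp]
            simp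
        · simp [hpa]
    _ = _ := by
        rw [lintegral_const_mul _ hm2, lintegral_map hm2 (by fun_prop)]

/-- A binary label of the observed data whose conditional law given covariates and treatment does
not depend on the covariates, and whose likelihood ratio between the arms is the power of `Λ` in
the extremal weights. -/
theorem exists_label (P : ProbabilityMeasure (Obs 𝒳)) {Λ : ℝ} (hΛ : 1 ≤ Λ)
    (hq : 1 < Λ → ∀ a, ∀ᵐ z ∂(P : Measure (Obs 𝒳)), ¬ (z.2.2 = a ∧ z.2.1 = cutoff P Λ a z.1)) :
    ∃ (L : Obs 𝒳 → Bool) (c : Bool → Bool → ℝ), Measurable L ∧ (∀ a u, 0 ≤ c a u) ∧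
      (∀ (a u : Bool) (h : 𝒳 → ℝ≥0∞), Measurable h →
        ∫⁻ z, (if z.2.2 = a ∧ L z = u then h z.1 else 0) ∂(P : Measure (Obs 𝒳)) =
          ENNReal.ofReal (c a u) *
            ∫⁻ z, (if z.2.2 = a then h z.1 else 0) ∂(P : Measure (Obs 𝒳))) ∧
      ∀ z, 0 < c (z.2.2) (L z) ∧ c (!z.2.2) (L z) =
        Λ ^ (if z.2.2 = true then -sgn (z.2.1 - cutoff P Λ z.2.2 z.1)
          else sgn (z.2.1 - cutoff P Λ z.2.2 z.1)) * c z.2.2 (L z) := by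
  rcases hΛ.eq_or_lt with rfl | hΛ'
  -- For `Λ = 1` the extremal weights ignore the cutoffs, so a constant label suffices and atoms are
  -- harmless.
  · refine ⟨fun _ => true, fun _ u => if u = true then 1 else 0, measurable_const, ?_, ?_, ?_⟩
    · intro a u; dsimp only; split_ifs <;> norm_num
    · intro a u h _
      cases u <;> simp
    · intro z; simp
  · have hΛ0 : 0 < Λ := by linarith
    have hc : Measurable fun z : Obs 𝒳 => cutoff P Λ z.2.2 z.1 := by
      have : (fun z : Obs 𝒳 => cutoff P Λ z.2.2 z.1) =
          fun z => if z.2.2 = true then cutoff P Λ true z.1 else cutoff P Λ false z.1 := by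
        ext ⟨x, y, b⟩; cases b <;> rfl
      rw [this]
      exact Measurable.ite (measurable_snd.snd (measurableSet_singleton true))
        ((measurable_cutoff P hΛ true).comp measurable_fst)
        ((measurable_cutoff P hΛ false).comp measurable_fst)
    have hL : Measurable fun z : Obs 𝒳 => decide (cutoff P Λ z.2.2 z.1 ≤ z.2.1) :=
      measurable_to_bool (by
        have : (fun z : Obs 𝒳 => decide (cutoff P Λ z.2.2 z.1 ≤ z.2.1)) ⁻¹' {true} =
            {z | cutoff P Λ z.2.2 z.1 ≤ z.2.1} := by ext; simp
        rw [this]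
        exact measurableSet_le hc (by fun_prop))
    -- The levels of the two arms sum to `1`, so changing arm swaps `1 / (1 + Λ)` and `Λ / (1 + Λ)`.
    refine ⟨_, fun a u => if u = true then 1 - cutoffLevel Λ a else cutoffLevel Λ a, hL, ?_,
      fun a u h hh => lintegral_cutoff P hΛ a u (hq hΛ' a) hh, ?_⟩
    · intro a u
      dsimp only
      split_ifs
      · linarith [cutoffLevel_lt_one hΛ a]
      · exact (cutoffLevel_pos hΛ a).le
    · rintro ⟨x, y, b⟩
      dsimp only
      have h1 := cutoffLevel_lt_one hΛ b
      have h0 := cutoffLevel_pos hΛ b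
      by_cases hy : cutoff P Λ b x ≤ y
      · have hs : sgn (y - cutoff P Λ b x) = 1 := if_pos (sub_nonneg.2 hy)
        simp only [hy, decide_true, if_true, hs]
        refine ⟨by linarith, ?_⟩
        cases b <;> simp [cutoffLevel] <;> field_simp <;> ring
      · have hs : sgn (y - cutoff P Λ b x) = -1 := if_neg (by rwa [sub_nonneg])
        simp only [hy, decide_false, hs]
        refine ⟨by simpa using h0, ?_⟩
        cases b <;> simp [cutoffLevel] <;> field_simp

end

end MSM

/-! ### Construction of the extremal law. -/

namespace MSM

noncomputable section

open scoped ENNReal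

variable {𝒳 : Type*} [MeasurableSpace 𝒳] {k : ℕ}

/-- The propensity depends only on the joint law of `(X, U, A)`, which does not involve the
unobserved outcome. -/
theorem condDistrib_A_XU_eq {P : ProbabilityMeasure (Obs 𝒳)} {V : Obs 𝒳 → Fin k → ℝ}
    (hV : Measurable V) {Q : ProbabilityMeasure (Full 𝒳 k)}
    (h : (Q : Measure (Full 𝒳 k)).map (fun o => (toObs o, U o)) =
      (P : Measure (Obs 𝒳)).map fun z => (z, V z)) :
    condDistrib A XU (Q : Measure (Full 𝒳 k)) =
      condDistrib (fun z : Obs 𝒳 => z.2.2) (fun z : Obs 𝒳 => (z.1, V z)) (P : Measure (Obs 𝒳)) := by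
  rw [condDistrib, condDistrib]
  congr 1
  have hf : Measurable fun p : Obs 𝒳 × (Fin k → ℝ) => ((p.1.1, p.2), p.1.2.2) := by fun_prop
  have := congrArg (Measure.map fun p : Obs 𝒳 × (Fin k → ℝ) => ((p.1.1, p.2), p.1.2.2)) h
  rw [Measure.map_map hf (measurable_toObs.prodMk measurable_U),
    Measure.map_map hf (by fun_prop)] at this
  exact this

theorem lintegral_bool (m : Measure Bool) (f : Bool → ℝ≥0∞) :
    ∫⁻ b, f b ∂m = m {true} * f true + m {false} * f false := by
  rw [lintegral_fintype, Fintype.sum_bool, mul_comm, mul_comm (f false)]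

/-- Any measurable function `V` of the observed data is the confounder of a latent unconfounded law
that is compatible with the observed data: given `X` and `V`, draw the potential outcomes
independently from the conditional laws of the outcome in the two arms. -/
theorem exists_latentUnconfounded [StandardBorelSpace 𝒳] (P : ProbabilityMeasure (Obs 𝒳))
    {V : Obs 𝒳 → Fin k → ℝ} (hV : Measurable V) :
    ∃ Q : ProbabilityMeasure (Full 𝒳 k), LatentUnconfounded Q ∧
      (Q : Measure (Full 𝒳 k)).map (fun o => (toObs o, U o)) =
        (P : Measure (Obs 𝒳)).map fun z => (z, V z) := by
  set μ := (P : Measure (Obs 𝒳)) with hμ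
  let ρ : Measure (𝒳 × (Fin k → ℝ)) := μ.map fun z => (z.1, V z)
  have hρ : IsProbabilityMeasure ρ := Measure.isProbabilityMeasure_map (by fun_prop)
  let κ := condDistrib (fun z : Obs 𝒳 => z.2.1) (fun z : Obs 𝒳 => ((z.1, V z), z.2.2)) μ
  let η := condDistrib (fun z : Obs 𝒳 => z.2.2) (fun z : Obs 𝒳 => (z.1, V z)) μ
  let κa : Bool → Kernel (𝒳 × (Fin k → ℝ)) ℝ := fun a => κ.comap (fun p => (p, a)) (by fun_prop)
  have hκa : ∀ a, IsMarkovKernel (κa a) := fun a => by dsimp only [κa]; infer_instance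
  let N : Measure ((𝒳 × (Fin k → ℝ)) × (ℝ × ℝ)) := ρ ⊗ₘ (κa true ×ₖ κa false)
  -- The treatment kernel ignores the potential outcomes, which is latent unconfoundedness.
  let M : Measure (((𝒳 × (Fin k → ℝ)) × (ℝ × ℝ)) × Bool) := N ⊗ₘ η.prodMkRight (ℝ × ℝ)
  let e : ((𝒳 × (Fin k → ℝ)) × (ℝ × ℝ)) × Bool → Full 𝒳 k :=
    fun p => (p.1.2, p.1.1.1, p.2, p.1.1.2)
  have he : Measurable e := by fun_prop
  let Q : ProbabilityMeasure (Full 𝒳 k) :=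
    ⟨M.map e, Measure.isProbabilityMeasure_map he.aemeasurable⟩
  have hQ : (Q : Measure (Full 𝒳 k)) = M.map e := rfl
  have hdis1 : ρ ⊗ₘ η = μ.map fun z : Obs 𝒳 => ((z.1, V z), z.2.2) :=
    compProd_map_condDistrib (by fun_prop)
  have hdis2 : (μ.map fun z : Obs 𝒳 => ((z.1, V z), z.2.2)) ⊗ₘ κ =
      μ.map fun z : Obs 𝒳 => (((z.1, V z), z.2.2), z.2.1) :=
    compProd_map_condDistrib (by fun_prop)
  have hTU : Measurable fun o : Full 𝒳 k => (toObs o, U o) := measurable_toObs.prodMk measurable_U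
  have hlint : ∀ f : Obs 𝒳 × (Fin k → ℝ) → ℝ≥0∞, Measurable f →
      ∫⁻ p, f p ∂((Q : Measure (Full 𝒳 k)).map fun o => (toObs o, U o)) =
        ∫⁻ p, f p ∂(μ.map fun z => (z, V z)) := by
    intro f hf
    have hF : Measurable fun p : (((𝒳 × (Fin k → ℝ)) × Bool) × ℝ) =>
      f ((p.1.1.1, p.2, p.1.2), p.1.1.2) := hf.comp (by fun_prop)
    have hFa : ∀ (p : 𝒳 × (Fin k → ℝ)) (a : Bool), Measurable fun y : ℝ => f ((p.1, y, a), p.2) :=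
      fun p a => hf.comp (by fun_prop)
    have hG : Measurable fun p : ((𝒳 × (Fin k → ℝ)) × (ℝ × ℝ)) × Bool =>
        f (toObs (e p), U (e p)) := (hf.comp hTU).comp he
    have hright : ∫⁻ p, f p ∂(μ.map fun z => (z, V z)) =
        ∫⁻ p, (η p {true} * ∫⁻ y, f ((p.1, y, true), p.2) ∂(κa true p) +
          η p {false} * ∫⁻ y, f ((p.1, y, false), p.2) ∂(κa false p)) ∂ρ := by
      have h1 : ∫⁻ p, f p ∂(μ.map fun z => (z, V z)) =
          ∫⁻ p, f ((p.1.1.1, p.2, p.1.2), p.1.1.2)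
            ∂(μ.map fun z : Obs 𝒳 => (((z.1, V z), z.2.2), z.2.1)) := by
        rw [lintegral_map hf (by fun_prop), lintegral_map hF (by fun_prop)]
      rw [h1, ← hdis2, ← hdis1, Measure.lintegral_compProd hF,
        Measure.lintegral_compProd hF.lintegral_kernel_prod_right']
      refine lintegral_congr fun p => ?_
      rw [lintegral_bool]
      rfl
    have hfe : Measurable fun o : Full 𝒳 k => f (toObs o, U o) := hf.comp hTU
    rw [hright, lintegral_map hf hTU, hQ, lintegral_map hfe he,
      Measure.lintegral_compProd hG, Measure.lintegral_compProd hG.lintegral_kernel_prod_right']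
    -- For each treatment only one potential outcome is observed; the other factor of the product
    -- kernel integrates to `1`.
    refine lintegral_congr fun p => ?_
    have h2 : ∀ y : ℝ × ℝ,
        ∫⁻ a, f (toObs (e ((p, y), a)), U (e ((p, y), a))) ∂(η.prodMkRight (ℝ × ℝ) (p, y)) =
          η p {true} * f ((p.1, y.1, true), p.2) + η p {false} * f ((p.1, y.2, false), p.2) := by
      intro y
      rw [lintegral_bool]
      rfl
    simp only [h2]
    have ht : Measurable fun y : ℝ × ℝ => f ((p.1, y.1, true), p.2) :=
      (hFa p true).comp measurable_fst
    have hf' : Measurable fun y : ℝ × ℝ => f ((p.1, y.2, false), p.2) :=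
      (hFa p false).comp measurable_snd
    rw [lintegral_add_left (ht.const_mul _), lintegral_const_mul _ ht, lintegral_const_mul _ hf',
      Kernel.prod_apply]
    congr 2
    · rw [← lintegral_map (f := fun y => f ((p.1, y, true), p.2)) (hFa p true) measurable_fst,
        Measure.map_fst_prod]
      simp
    · rw [← lintegral_map (f := fun y => f ((p.1, y, false), p.2)) (hFa p false) measurable_snd,
        Measure.map_snd_prod]
      simp
  have hlaw : (Q : Measure (Full 𝒳 k)).map (fun o => (toObs o, U o)) =
      μ.map fun z => (z, V z) := by
    ext s hs
    rw [← lintegral_indicator_one hs, ← lintegral_indicator_one hs,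
      hlint _ (measurable_one.indicator hs)]
  refine ⟨Q, ?_, hlaw⟩
  have hY : Measurable fun o : Full 𝒳 k => (Y₁ o, Y₀ o) := measurable_Y₁.prodMk measurable_Y₀
  rw [latentUnconfounded_iff, condDistrib_A_XU_eq hV hlaw, hQ,
    Measure.map_map ((measurable_XU.prodMk hY).prodMk measurable_A) he,
    Measure.map_map (measurable_XU.prodMk hY) he]
  have h1 : (fun o : Full 𝒳 k => ((XU o, (Y₁ o, Y₀ o)), A o)) ∘ e = id := rfl
  have h2 : (fun o : Full 𝒳 k => (XU o, (Y₁ o, Y₀ o))) ∘ e = Prod.fst := rfl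
  rw [h1, h2, Measure.map_id]
  have h3 : M.map Prod.fst = N := Measure.fst_compProd N _
  rw [h3]

/-- Bayes' rule for the propensity given the covariates and a binary label. -/
theorem condDistrib_label (P : ProbabilityMeasure (Obs 𝒳)) {L : Obs 𝒳 → Bool} (hL : Measurable L)
    {c : Bool → Bool → ℝ}
    (hc : ∀ (a u : Bool) (h : 𝒳 → ℝ≥0∞), Measurable h →
      ∫⁻ z, (if z.2.2 = a ∧ L z = u then h z.1 else 0) ∂(P : Measure (Obs 𝒳)) =
        ENNReal.ofReal (c a u) *
          ∫⁻ z, (if z.2.2 = a then h z.1 else 0) ∂(P : Measure (Obs 𝒳)))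
    {enc : Bool → Fin k → ℝ} (henc : Function.Injective enc) (a u : Bool) :
    ∀ᵐ x ∂((P : Measure (Obs 𝒳)).map fun z => z.1),
      (∑ b, ENNReal.ofReal (c b u) * condDistrib (fun z : Obs 𝒳 => z.2.2) (fun z : Obs 𝒳 => z.1)
        (P : Measure (Obs 𝒳)) x {b}) *
        condDistrib (fun z : Obs 𝒳 => z.2.2) (fun z : Obs 𝒳 => (z.1, enc (L z)))
          (P : Measure (Obs 𝒳)) (x, enc u) {a} =
      ENNReal.ofReal (c a u) * condDistrib (fun z : Obs 𝒳 => z.2.2) (fun z : Obs 𝒳 => z.1)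
        (P : Measure (Obs 𝒳)) x {a} := by
  set μ := (P : Measure (Obs 𝒳)) with hμ
  set κ := condDistrib (fun z : Obs 𝒳 => z.2.2) (fun z : Obs 𝒳 => z.1) μ with hκ
  set η := condDistrib (fun z : Obs 𝒳 => z.2.2) (fun z : Obs 𝒳 => (z.1, enc (L z))) μ with hη
  have hκm : ∀ b, Measurable fun x => κ x {b} := fun b => κ.measurable_coe (measurableSet_singleton b)
  have hηm : Measurable fun x => η (x, enc u) {a} :=
    (η.measurable_coe (measurableSet_singleton a)).comp (by fun_prop)
  have hV : Measurable fun z : Obs 𝒳 => enc (L z) := (measurable_of_countable enc).comp hL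
  have hprob : IsProbabilityMeasure (μ.map fun z : Obs 𝒳 => z.1) :=
    Measure.isProbabilityMeasure_map (by fun_prop)
  have hleft : Measurable fun x => (∑ b, ENNReal.ofReal (c b u) * κ x {b}) * η (x, enc u) {a} :=
    (Finset.measurable_sum _ fun b _ => (hκm b).const_mul _).mul hηm
  have hcond : ∀ (b : Bool) (h : 𝒳 → ℝ≥0∞), Measurable h →
      ∫⁻ z, (if z.2.2 = b ∧ L z = u then h z.1 else 0) ∂μ =
        ∫⁻ z, ENNReal.ofReal (c b u) * κ z.1 {b} * h z.1 ∂μ := by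
    intro b h hh
    rw [hc b u h hh, lintegral_treatment P b hh, ← lintegral_const_mul]
    · simp only [mul_assoc]; rfl
    · exact ((hκm b).comp measurable_fst).mul (hh.comp measurable_fst)
  -- Over any `S`, both sides integrate to `P(X ∈ S, L = u, A = a)`.
  refine ae_eq_of_forall_setLIntegral_eq_of_sigmaFinite hleft ((hκm a).const_mul _) ?_
  intro S hS _
  rw [setLIntegral_map hS hleft measurable_fst,
    setLIntegral_map hS ((hκm a).const_mul _) measurable_fst,
    ← lintegral_indicator (measurable_fst hS), ← lintegral_indicator (measurable_fst hS)]
  have hh : Measurable (S.indicator fun x => η (x, enc u) {a}) := hηm.indicator hS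
  have h1 : ∫⁻ z : Obs 𝒳, ((fun z : Obs 𝒳 => z.1) ⁻¹' S).indicator (fun z : Obs 𝒳 =>
      (∑ b, ENNReal.ofReal (c b u) * κ z.1 {b}) * η (z.1, enc u) {a}) z ∂μ =
      ∫⁻ z, (if L z = u then S.indicator (fun x => η (x, enc u) {a}) z.1 else 0) ∂μ := by
    have e1 : ∀ z : Obs 𝒳, ((fun z : Obs 𝒳 => z.1) ⁻¹' S).indicator (fun z : Obs 𝒳 =>
      (∑ b, ENNReal.ofReal (c b u) * κ z.1 {b}) * η (z.1, enc u) {a}) z =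
        ENNReal.ofReal (c true u) * κ z.1 {true} * S.indicator (fun x => η (x, enc u) {a}) z.1 +
        ENNReal.ofReal (c false u) * κ z.1 {false} *
          S.indicator (fun x => η (x, enc u) {a}) z.1 := by
      intro z
      by_cases hz : z.1 ∈ S
      · simp [hz, add_mul]
      · simp [hz]
    have e2 : ∀ z : Obs 𝒳, (if L z = u then S.indicator (fun x => η (x, enc u) {a}) z.1 else 0) =
        (if z.2.2 = true ∧ L z = u then S.indicator (fun x => η (x, enc u) {a}) z.1 else 0) +
        (if z.2.2 = false ∧ L z = u then S.indicator (fun x => η (x, enc u) {a}) z.1 else 0) := by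
      intro z
      cases z.2.2 <;> simp
    rw [lintegral_congr e1, lintegral_congr e2, lintegral_add_left, lintegral_add_left,
      hcond true _ hh, hcond false _ hh]
    · refine Measurable.ite ?_ (hh.comp measurable_fst) measurable_const
      exact (measurableSet_eq_fun (by fun_prop) measurable_const).inter
        (measurableSet_eq_fun hL measurable_const)
    · exact (((hκm true).comp measurable_fst).const_mul _).mul (hh.comp measurable_fst)
  have h2 : ∫⁻ z, (if L z = u then S.indicator (fun x => η (x, enc u) {a}) z.1 else 0) ∂μ =
      μ ((fun z : Obs 𝒳 => (z.1, enc (L z))) ⁻¹' (S ×ˢ {enc u}) ∩ (fun z => z.2.2) ⁻¹' {a}) := by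
    rw [← setLIntegral_preimage_condDistrib (measurable_fst.prodMk hV) (by fun_prop)
      (measurableSet_singleton a) (hS.prod (measurableSet_singleton (enc u))),
      ← lintegral_indicator ((measurable_fst.prodMk hV)
        (hS.prod (measurableSet_singleton (enc u))))]
    refine lintegral_congr fun z => ?_
    by_cases hz : z.1 ∈ S <;> by_cases hu : L z = u <;>
      simp [hz, hu, henc.eq_iff, hη]
  have h3 : μ ((fun z : Obs 𝒳 => (z.1, enc (L z))) ⁻¹' (S ×ˢ {enc u}) ∩ (fun z => z.2.2) ⁻¹' {a}) =
      ∫⁻ z, (if z.2.2 = a ∧ L z = u then S.indicator (fun _ => 1) z.1 else 0) ∂μ := by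
    rw [← lintegral_indicator_one (((measurable_fst.prodMk hV)
      (hS.prod (measurableSet_singleton (enc u)))).inter
        (measurable_snd.snd (measurableSet_singleton a)))]
    refine lintegral_congr fun z => ?_
    by_cases hz : z.1 ∈ S <;> by_cases hu : L z = u <;> by_cases ha : z.2.2 = a <;>
      simp [hz, hu, ha, henc.eq_iff]
  refine h1.trans (h2.trans (h3.trans ?_))
  rw [hcond a _ (measurable_const.indicator hS)]
  refine lintegral_congr fun z => ?_
  by_cases hz : z.1 ∈ S <;> simp [hz]

/-- The extremal weights are the inverse probability weights of a law in the uncertainty set. -/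
theorem exists_extremal_law [StandardBorelSpace 𝒳] (hk : 1 ≤ k) {Λ : ℝ} (hΛ : 1 ≤ Λ)
    (P : ProbabilityMeasure (Obs 𝒳))
    (hoverlap : ∀ᵐ z ∂(P : Measure (Obs 𝒳)), ∀ a, 0 < propensity P a z.1)
    (hq : 1 < Λ → ∀ a, ∀ᵐ z ∂(P : Measure (Obs 𝒳)), ¬ (z.2.2 = a ∧ z.2.1 = cutoff P Λ a z.1)) :
    ∃ Q ∈ uncertaintySet k Λ P, ∀ a, ∀ᵐ o ∂(Q : Measure (Full 𝒳 k)),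
      ipw Q a o = if A o = a then extremalWeight P Λ a (X o) (Y o) else 0 := by
  have hΛ0 : 0 < Λ := by linarith
  obtain ⟨L, c, hL, hc0, hc, hcΛ⟩ := exists_label P hΛ hq
  -- Injectivity needs a coordinate, hence `1 ≤ k`.
  let enc : Bool → Fin k → ℝ := fun b _ => if b = true then 1 else 0
  have henc : Function.Injective enc := by
    intro b b' h
    have := congrFun h ⟨0, hk⟩
    cases b <;> cases b' <;> simp [enc] at this ⊢
  have hV : Measurable fun z : Obs 𝒳 => enc (L z) := (measurable_of_countable enc).comp hL
  obtain ⟨Q, hlat, hlaw⟩ := exists_latentUnconfounded P hV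
  have hTU : Measurable fun o : Full 𝒳 k => (toObs o, U o) := measurable_toObs.prodMk measurable_U
  have hobs : obsLaw Q = P := by
    apply Subtype.ext
    have := congrArg (Measure.map Prod.fst) hlaw
    rw [Measure.map_map measurable_fst hTU, Measure.map_map measurable_fst (by fun_prop)] at this
    refine Eq.trans ?_ (this.trans ?_)
    · rfl
    · exact Measure.map_id
  have hη := condDistrib_A_XU_eq hV hlaw
  have hmain : ∀ᵐ z ∂(P : Measure (Obs 𝒳)), (∀ b, 0 < c b (L z)) ∧
      (∀ b, 0 < propensity P b z.1) ∧ ∀ a,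
      (condDistrib A XU (Q : Measure (Full 𝒳 k)) (z.1, enc (L z))).real {a} =
        c a (L z) * propensity P a z.1 /
          (c a (L z) * propensity P a z.1 + c (!a) (L z) * propensity P (!a) z.1) := by
    have h1 : ∀ᵐ z ∂(P : Measure (Obs 𝒳)), ∀ u a, _ :=
      ae_all_iff.2 fun u => ae_all_iff.2 fun a =>
        ae_of_ae_map (by fun_prop) (condDistrib_label P hL hc henc a u)
    filter_upwards [h1, hoverlap] with z hz he
    have hreal : ∀ a, (c true (L z) * propensity P true z.1 +
        c false (L z) * propensity P false z.1) *
        (condDistrib A XU (Q : Measure (Full 𝒳 k)) (z.1, enc (L z))).real {a} =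
        c a (L z) * propensity P a z.1 := by
      intro a
      have h2 := congrArg ENNReal.toReal (hz (L z) a)
      rw [← hη, Fintype.sum_bool, ENNReal.toReal_mul, ENNReal.toReal_mul,
        ENNReal.toReal_add (by finiteness) (by finiteness), ENNReal.toReal_mul, ENNReal.toReal_mul,
        ENNReal.toReal_ofReal (hc0 _ _), ENNReal.toReal_ofReal (hc0 _ _),
        ENNReal.toReal_ofReal (hc0 _ _)] at h2
      exact h2
    -- The label has positive probability in the own arm; in the other arm that probability is
    -- multiplied by a power of `Λ`.
    have hpos : ∀ b, 0 < c b (L z) := by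
      intro b
      obtain ⟨h3, h4⟩ := hcΛ z
      by_cases hb : b = z.2.2
      · rw [hb]; exact h3
      · have : b = !z.2.2 := by revert hb; cases b <;> cases z.2.2 <;> simp
        rw [this, h4]
        positivity
    have p1 := mul_pos (hpos true) (he true)
    have p2 := mul_pos (hpos false) (he false)
    refine ⟨hpos, he, fun a => ?_⟩
    specialize hreal a
    rw [eq_div_iff (by cases a <;> simp <;> linarith)]
    refine Eq.trans ?_ hreal
    cases a <;> simp <;> ring
  have htransfer : ∀ p : Obs 𝒳 → (Fin k → ℝ) → Prop,
      MeasurableSet {q : Obs 𝒳 × (Fin k → ℝ) | p q.1 q.2} →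
      (∀ᵐ z ∂(P : Measure (Obs 𝒳)), p z (enc (L z))) →
      ∀ᵐ o ∂(Q : Measure (Full 𝒳 k)), p (toObs o) (U o) := by
    intro p hp h
    have h' : ∀ᵐ q ∂((Q : Measure (Full 𝒳 k)).map fun o => (toObs o, U o)), p q.1 q.2 := by
      rw [hlaw, ae_map_iff (by fun_prop) hp]
      exact h
    exact ae_of_ae_map hTU.aemeasurable h'
  have hpm : ∀ a, Measurable fun q : Obs 𝒳 × (Fin k → ℝ) =>
      (condDistrib A XU (Q : Measure (Full 𝒳 k)) (q.1.1, q.2)).real {a} := fun a =>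
    ((Kernel.measurable_coe _ (measurableSet_singleton a)).comp (by fun_prop)).ennreal_toReal
  refine ⟨Q, ⟨hlat, hobs, ?_⟩, fun a => ?_⟩
  · have hnom : ∀ x, nominalPropensity Q x = propensity P true x := by
      intro x
      rw [nominalPropensity, propensity, condDistrib_A_X, hobs]
    have hodds : Measurable odds := measurable_id.div (measurable_const.sub measurable_id)
    have hm : Measurable fun q : Obs 𝒳 × (Fin k → ℝ) =>
        odds ((condDistrib A XU (Q : Measure (Full 𝒳 k)) (q.1.1, q.2)).real {true}) /
          odds (propensity P true q.1.1) :=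
      (hodds.comp (hpm true)).div
        ((hodds.comp (measurable_propensity P true)).comp (by fun_prop))
    have := htransfer (fun z v =>
      1 / Λ ≤ odds ((condDistrib A XU (Q : Measure (Full 𝒳 k)) (z.1, v)).real {true}) /
          odds (propensity P true z.1) ∧
        odds ((condDistrib A XU (Q : Measure (Full 𝒳 k)) (z.1, v)).real {true}) /
          odds (propensity P true z.1) ≤ Λ)
      ((measurableSet_le measurable_const hm).inter (measurableSet_le hm measurable_const)) (by
        filter_upwards [hmain] with z ⟨h1, h2, h3⟩
        have e1 := h3 true
        have c1 := h1 true
        have c0 := h1 false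
        have p1 := h2 true
        have p0 := h2 false
        have pn := propensity_not P true z.1
        simp only [Bool.not_true] at e1 pn
        -- The nominal odds cancel, leaving the likelihood ratio of the label.
        have hratio : odds ((condDistrib A XU (Q : Measure (Full 𝒳 k))
            (z.1, enc (L z))).real {true}) / odds (propensity P true z.1) =
            c true (L z) / c false (L z) := by
          rw [e1, odds, odds, ← pn]
          field_simp
          ring
        rw [hratio]
        have hΛinv : 1 / Λ ≤ Λ := by rw [div_le_iff₀ hΛ0]; nlinarith
        have hcases : c true (L z) / c false (L z) = Λ ∨ c true (L z) / c false (L z) = 1 / Λ := by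
          obtain ⟨-, h4⟩ := hcΛ z
          have hs : sgn (z.2.1 - cutoff P Λ z.2.2 z.1) = 1 ∨
              sgn (z.2.1 - cutoff P Λ z.2.2 z.1) = -1 := by
            rw [sgn]; split_ifs <;> simp
          rw [div_eq_iff c0.ne', div_eq_iff c0.ne']
          cases hz : z.2.2 <;> rw [hz] at h4 hs <;> rcases hs with hs | hs <;>
            simp only [hs, Bool.not_true, Bool.not_false] at h4 <;> norm_num at h4 <;> rw [h4] <;>
            field_simp <;> simp
        rcases hcases with h | h <;> rw [h]
        · exact ⟨hΛinv, le_rfl⟩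
        · exact ⟨le_rfl, hΛinv⟩)
    filter_upwards [this] with o ho
    rw [hnom]
    exact ho
  · have := htransfer (fun z v => z.2.2 = a →
      ((condDistrib A XU (Q : Measure (Full 𝒳 k)) (z.1, v)).real {a})⁻¹ =
        extremalWeight P Λ a z.1 z.2.1)
      (by
        have h1 : MeasurableSet {q : Obs 𝒳 × (Fin k → ℝ) | q.1.2.2 = a} :=
          measurableSet_eq_fun (by fun_prop) measurable_const
        have h2 : MeasurableSet {q : Obs 𝒳 × (Fin k → ℝ) |
            ((condDistrib A XU (Q : Measure (Full 𝒳 k)) (q.1.1, q.2)).real {a})⁻¹ =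
              extremalWeight P Λ a q.1.1 q.1.2.1} :=
          measurableSet_eq_fun (hpm a).inv
            ((measurable_extremalWeight P hΛ a).comp
              (g := fun p : 𝒳 × ℝ => extremalWeight P Λ a p.1 p.2)
              (f := fun q : Obs 𝒳 × (Fin k → ℝ) => (q.1.1, q.1.2.1)) (by fun_prop))
        convert h1.compl.union h2 using 1
        ext q
        simp [imp_iff_not_or]) (by
        filter_upwards [hmain] with z ⟨h1, h2, h3⟩ hza
        obtain ⟨-, h4⟩ := hcΛ z
        rw [hza] at h4
        have pa := h2 a
        have ca := h1 a
        rw [h3 a, h4, propensity_not, extremalWeight]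
        field_simp)
    filter_upwards [this] with o ho
    rw [ipw]
    split_ifs with h
    · exact ho h
    · rfl

end

end MSM

/-! ### Integrability, optimality of the extremal law, and its value. -/

namespace MSM

noncomputable section

open Filter Topology

variable {𝒳 : Type*} [MeasurableSpace 𝒳] {k : ℕ}

section Transfer

variable {Q : ProbabilityMeasure (Full 𝒳 k)} {P : ProbabilityMeasure (Obs 𝒳)}

theorem map_toObs (h : obsLaw Q = P) :
    (Q : Measure (Full 𝒳 k)).map toObs = (P : Measure (Obs 𝒳)) := by
  rw [← h]; rfl

theorem integrable_toObs_iff (h : obsLaw Q = P) {F : Obs 𝒳 → ℝ} (hF : Measurable F) :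
    Integrable (fun o => F (toObs o)) (Q : Measure (Full 𝒳 k)) ↔
      Integrable F (P : Measure (Obs 𝒳)) := by
  rw [← map_toObs h, integrable_map_measure hF.aestronglyMeasurable measurable_toObs.aemeasurable]
  rfl

theorem integral_toObs (h : obsLaw Q = P) {F : Obs 𝒳 → ℝ} (hF : Measurable F) :
    ∫ o, F (toObs o) ∂(Q : Measure (Full 𝒳 k)) = ∫ z, F z ∂(P : Measure (Obs 𝒳)) := by
  rw [← map_toObs h, integral_map measurable_toObs.aemeasurable hF.aestronglyMeasurable]

theorem overlap {Λ : ℝ} (hΛ : 1 ≤ Λ) (h : obsLaw Q = P) (hQ : OddsRatioBounded Λ Q) :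
    ∀ᵐ z ∂(P : Measure (Obs 𝒳)), ∀ a, 0 < propensity P a z.1 := by
  rw [← map_toObs h, ae_map_iff measurable_toObs.aemeasurable]
  · filter_upwards [ae_all_iff.2 (ipw_bounds hΛ h hQ)] with o ho a
    exact (ho a).2.1
  · rw [Set.ofPred_forall]
    exact MeasurableSet.iInter fun a => measurableSet_lt measurable_const
      ((measurable_propensity P a).comp measurable_fst)

end Transfer

/-- The largest inverse probability weight in arm `a` under the marginal sensitivity model. -/
def maxWeight (P : ProbabilityMeasure (Obs 𝒳)) (Λ : ℝ) (a : Bool) (z : Obs 𝒳) : ℝ :=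
  if z.2.2 = a then 1 + (1 - propensity P a z.1) / propensity P a z.1 * Λ else 0

theorem measurable_maxWeight (P : ProbabilityMeasure (Obs 𝒳)) (Λ : ℝ) (a : Bool) :
    Measurable (maxWeight P Λ a) := by
  have := (measurable_propensity P a).comp (measurable_fst : Measurable fun z : Obs 𝒳 => z.1)
  exact Measurable.ite (measurableSet_eq_fun (by fun_prop) measurable_const)
    (measurable_const.add (((measurable_const.sub this).div this).mul measurable_const))
    measurable_const

/-- The extremal weight on the event `A = a`, and `0` off it. -/
def armWeight (P : ProbabilityMeasure (Obs 𝒳)) (Λ : ℝ) (a : Bool) (z : Obs 𝒳) : ℝ :=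
  if z.2.2 = a then extremalWeight P Λ a z.1 z.2.1 else 0

theorem measurable_armWeight (P : ProbabilityMeasure (Obs 𝒳)) {Λ : ℝ} (hΛ : 1 ≤ Λ) (a : Bool) :
    Measurable (armWeight P Λ a) :=
  Measurable.ite (measurableSet_eq_fun (by fun_prop) measurable_const)
    ((measurable_extremalWeight P hΛ a).comp (g := fun p : 𝒳 × ℝ => extremalWeight P Λ a p.1 p.2)
      (f := fun z : Obs 𝒳 => (z.1, z.2.1)) (by fun_prop)) measurable_const

/-- The ends of the band are comparable, `1 + r Λ ≤ Λ² (1 + r / Λ)`, so integrability under one law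
of the model yields a bound in terms of `P` alone. -/
theorem integrable_maxWeight [StandardBorelSpace 𝒳] {Λ : ℝ} (hΛ : 1 ≤ Λ)
    {Q : ProbabilityMeasure (Full 𝒳 k)} {P : ProbabilityMeasure (Obs 𝒳)} (hP : obsLaw Q = P)
    (hlat : LatentUnconfounded Q) (hodds : OddsRatioBounded Λ Q) (a : Bool)
    (hint : Integrable (arm a) (Q : Measure (Full 𝒳 k))) :
    Integrable (fun z => maxWeight P Λ a z * z.2.1) (P : Measure (Obs 𝒳)) := by
  have hm : Measurable fun z : Obs 𝒳 => maxWeight P Λ a z * z.2.1 :=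
    (measurable_maxWeight P Λ a).mul (by fun_prop)
  have hΛ0 : 0 < Λ := by linarith
  have hb := ipw_bounds hΛ hP hodds a
  have h1 := ((ipw_identity hlat a (hb.mono fun o ho => ho.1) (φ := fun p => p.2)
    measurable_snd).1).2 hint
  rw [← integrable_toObs_iff hP hm]
  refine (h1.const_mul (Λ ^ 2)).mono (hm.comp measurable_toObs).aestronglyMeasurable ?_
  filter_upwards [hb] with o ⟨_, he0, he1, ho⟩
  rw [norm_mul, norm_mul, norm_mul, ← mul_assoc]
  refine mul_le_mul_of_nonneg_right ?_ (norm_nonneg _)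
  by_cases hA : A o = a
  · obtain ⟨hlow, -⟩ := ho hA
    have hr : 0 ≤ (1 - propensity P a (X o)) / propensity P a (X o) :=
      div_nonneg (by linarith) he0.le
    have e : maxWeight P Λ a (toObs o) =
        1 + (1 - propensity P a (X o)) / propensity P a (X o) * Λ := if_pos hA
    have hlow0 : 0 ≤ 1 + (1 - propensity P a (X o)) / propensity P a (X o) * Λ⁻¹ := by positivity
    rw [e, Real.norm_of_nonneg (by positivity), Real.norm_of_nonneg (by positivity),
      Real.norm_of_nonneg (hlow0.trans hlow)]
    calc 1 + (1 - propensity P a (X o)) / propensity P a (X o) * Λ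
        ≤ Λ ^ 2 + (1 - propensity P a (X o)) / propensity P a (X o) * Λ := by
          gcongr; nlinarith
      _ = Λ ^ 2 * (1 + (1 - propensity P a (X o)) / propensity P a (X o) * Λ⁻¹) := by
          field_simp
      _ ≤ _ := by gcongr
  · have e : maxWeight P Λ a (toObs o) = 0 := if_neg hA
    rw [e, norm_zero]
    positivity

/-- This carries integrability from `P` to every law in the uncertainty set. -/
theorem integrable_arm [StandardBorelSpace 𝒳] {Λ : ℝ} (hΛ : 1 ≤ Λ)
    {P : ProbabilityMeasure (Obs 𝒳)} {Q : ProbabilityMeasure (Full 𝒳 k)}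
    (hQ : Q ∈ uncertaintySet k Λ P) (a : Bool)
    (hint : Integrable (fun z => maxWeight P Λ a z * z.2.1) (P : Measure (Obs 𝒳))) :
    Integrable (arm a) (Q : Measure (Full 𝒳 k)) := by
  obtain ⟨hlat, hP, hodds⟩ := hQ
  have hm : Measurable fun z : Obs 𝒳 => maxWeight P Λ a z * z.2.1 :=
    (measurable_maxWeight P Λ a).mul (by fun_prop)
  have hΛ0 : 0 < Λ := by linarith
  have hb := ipw_bounds hΛ hP hodds a
  refine ((ipw_identity hlat a (hb.mono fun o ho => ho.1) (φ := fun p => p.2)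
    measurable_snd).1).1 ?_
  rw [← integrable_toObs_iff hP hm] at hint
  refine hint.mono ((measurable_ipw Q a).mul measurable_Y).aestronglyMeasurable ?_
  filter_upwards [hb] with o ⟨_, he0, he1, ho⟩
  rw [norm_mul, norm_mul]
  refine mul_le_mul_of_nonneg_right ?_ (norm_nonneg _)
  by_cases hA : A o = a
  · obtain ⟨hlow, hup⟩ := ho hA
    have hr : 0 ≤ (1 - propensity P a (X o)) / propensity P a (X o) :=
      div_nonneg (by linarith) he0.le
    have e : maxWeight P Λ a (toObs o) =
        1 + (1 - propensity P a (X o)) / propensity P a (X o) * Λ := if_pos hA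
    have hlow0 : 0 ≤ 1 + (1 - propensity P a (X o)) / propensity P a (X o) * Λ⁻¹ := by positivity
    rw [e, Real.norm_of_nonneg (hlow0.trans hlow), Real.norm_of_nonneg (by positivity)]
    exact hup
  · have e : ipw Q a o = 0 := if_neg hA
    rw [e, norm_zero]
    positivity

/-- A law in the uncertainty set whose inverse probability weights are the extremal ones. -/
structure IsExtremal [StandardBorelSpace 𝒳] (Λ : ℝ) (P : ProbabilityMeasure (Obs 𝒳))
    (Q : ProbabilityMeasure (Full 𝒳 k)) : Prop where
  mem : Q ∈ uncertaintySet k Λ P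
  ipw_eq : ∀ a, ∀ᵐ o ∂(Q : Measure (Full 𝒳 k)), ipw Q a o = armWeight P Λ a (toObs o)

/-- The extremal weights are functions of the observed data, so these means can be computed under
`P`. -/
theorem IsExtremal.mean [StandardBorelSpace 𝒳] {Λ : ℝ} (hΛ : 1 ≤ Λ)
    {P : ProbabilityMeasure (Obs 𝒳)} {Q : ProbabilityMeasure (Full 𝒳 k)} (hQ : IsExtremal Λ P Q)
    (a : Bool) {φ : 𝒳 × ℝ → ℝ} (hφ : Measurable φ) :
    (Integrable (fun z => armWeight P Λ a z * φ (z.1, z.2.1)) (P : Measure (Obs 𝒳)) ↔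
      Integrable (fun o => φ (X o, arm a o)) (Q : Measure (Full 𝒳 k))) ∧
    ∫ z, armWeight P Λ a z * φ (z.1, z.2.1) ∂(P : Measure (Obs 𝒳)) =
      ∫ o, φ (X o, arm a o) ∂(Q : Measure (Full 𝒳 k)) := by
  obtain ⟨hlat, hP, hodds⟩ := hQ.mem
  have hm : Measurable fun z : Obs 𝒳 => armWeight P Λ a z * φ (z.1, z.2.1) :=
    (measurable_armWeight P hΛ a).mul (hφ.comp (by fun_prop))
  obtain ⟨h1, h2⟩ := ipw_identity hlat a ((ipw_bounds hΛ hP hodds a).mono fun o ho => ho.1) hφ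
  have hae : (fun o => ipw Q a o * φ (X o, Y o)) =ᵐ[(Q : Measure (Full 𝒳 k))]
      fun o => armWeight P Λ a (toObs o) * φ ((toObs o).1, (toObs o).2.1) := by
    filter_upwards [hQ.ipw_eq a] with o ho
    rw [ho]; rfl
  rw [← h1, ← h2, integrable_congr hae, integral_congr_ae hae, ← integrable_toObs_iff hP hm,
    ← integral_toObs hP hm]
  exact ⟨Iff.rfl, rfl⟩

/-- The sign with which the mean of arm `a` enters the objective. -/
def armSign (a : Bool) : ℝ := if a = true then 1 else -1

/-- The right side is linear in `w`, and the extremal weight is the end of the band selected by the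
sign of its slope. -/
theorem extremalWeight_le {Λ : ℝ} (P : ProbabilityMeasure (Obs 𝒳)) (a : Bool) (x : 𝒳)
    (y w : ℝ) (hlow : 1 + (1 - propensity P a x) / propensity P a x * Λ⁻¹ ≤ w)
    (hup : w ≤ 1 + (1 - propensity P a x) / propensity P a x * Λ) :
    extremalWeight P Λ a x y * (armSign a * (y - cutoff P Λ a x)) ≤
      w * (armSign a * (y - cutoff P Λ a x)) := by
  rcases le_or_gt (cutoff P Λ a x) y with h | h
  · have hs : sgn (y - cutoff P Λ a x) = 1 := if_pos (sub_nonneg.2 h)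
    have h' := sub_nonneg.2 h
    cases a
    · simp only [extremalWeight, hs, armSign, Bool.false_eq_true, if_false, zpow_one]
      nlinarith
    · simp only [extremalWeight, hs, armSign, if_true, zpow_neg, zpow_one]
      nlinarith
  · have hs : sgn (y - cutoff P Λ a x) = -1 := if_neg (by rw [sub_nonneg]; exact not_le.2 h)
    have h' := sub_neg.2 h
    cases a
    · simp only [extremalWeight, hs, armSign, Bool.false_eq_true, if_false, zpow_neg, zpow_one]
      nlinarith
    · simp only [extremalWeight, hs, armSign, if_true, neg_neg, zpow_one]
      nlinarith

/-- The term `E[q(X) g(X)]` is determined by `P` and cancels, which leaves a pointwise comparison of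
weights. Boundedness of `q g` makes this term integrable. -/
theorem IsExtremal.le_of_bounded_cutoff [StandardBorelSpace 𝒳] {Λ : ℝ} (hΛ : 1 ≤ Λ)
    {P : ProbabilityMeasure (Obs 𝒳)} {Q Q' : ProbabilityMeasure (Full 𝒳 k)}
    (hQ : IsExtremal Λ P Q) (hQ' : Q' ∈ uncertaintySet k Λ P) (a : Bool)
    (hint : Integrable (fun z => maxWeight P Λ a z * z.2.1) (P : Measure (Obs 𝒳)))
    {g : 𝒳 → ℝ} (hg : Measurable g) (hg01 : ∀ x, g x ∈ Set.Icc (0 : ℝ) 1) {C : ℝ}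
    (hC : ∀ x, |cutoff P Λ a x * g x| ≤ C) :
    armSign a * ∫ o, arm a o * g (X o) ∂(Q : Measure (Full 𝒳 k)) ≤
      armSign a * ∫ o, arm a o * g (X o) ∂(Q' : Measure (Full 𝒳 k)) := by
  have hcut := measurable_cutoff P hΛ a
  have hφ : Measurable fun p : 𝒳 × ℝ => armSign a * (p.2 - cutoff P Λ a p.1) * g p.1 :=
    (measurable_const.mul (measurable_snd.sub (hcut.comp measurable_fst))).mul
      (hg.comp measurable_fst)
  have hqg : Measurable fun z : Obs 𝒳 => cutoff P Λ a z.1 * g z.1 :=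
    (hcut.comp measurable_fst).mul (hg.comp measurable_fst)
  have hsplit : ∀ R ∈ uncertaintySet k Λ P,
      Integrable (fun o => armSign a * (arm a o - cutoff P Λ a (X o)) * g (X o))
        (R : Measure (Full 𝒳 k)) ∧
      ∫ o, armSign a * (arm a o - cutoff P Λ a (X o)) * g (X o) ∂(R : Measure (Full 𝒳 k)) =
        armSign a * ∫ o, arm a o * g (X o) ∂(R : Measure (Full 𝒳 k)) -
          armSign a * ∫ z, cutoff P Λ a z.1 * g z.1 ∂(P : Measure (Obs 𝒳)) := by
    intro R hR
    have i1 : Integrable (fun o => arm a o * g (X o)) (R : Measure (Full 𝒳 k)) :=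
      (integrable_arm hΛ hR a hint).mul_bdd (c := 1)
        (hg.comp measurable_X).aestronglyMeasurable (ae_of_all _ fun o => by
          rw [Real.norm_of_nonneg (hg01 _).1]; exact (hg01 _).2)
    have i2 : Integrable (fun o => cutoff P Λ a (X o) * g (X o)) (R : Measure (Full 𝒳 k)) :=
      Integrable.of_bound ((hcut.comp measurable_X).mul (hg.comp measurable_X)).aestronglyMeasurable
        C (ae_of_all _ fun o => hC _)
    have e : (fun o => armSign a * (arm a o - cutoff P Λ a (X o)) * g (X o)) =
        fun o : Full 𝒳 k => armSign a * (arm a o * g (X o)) -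
          armSign a * (cutoff P Λ a (X o) * g (X o)) := by
      ext o; ring
    rw [e]
    refine ⟨(i1.const_mul _).sub (i2.const_mul _), ?_⟩
    rw [integral_sub (i1.const_mul _) (i2.const_mul _), integral_const_mul, integral_const_mul,
      ← integral_toObs hR.2.1 hqg]
    rfl
  obtain ⟨j1, s1⟩ := hsplit Q hQ.mem
  obtain ⟨j2, s2⟩ := hsplit Q' hQ'
  obtain ⟨m1, m2⟩ := hQ.mean hΛ a hφ
  obtain ⟨hlat, hP, hodds⟩ := hQ'
  have hb := ipw_bounds hΛ hP hodds a
  obtain ⟨n1, n2⟩ := ipw_identity hlat a (hb.mono fun o ho => ho.1) hφ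
  have hm : Measurable fun z : Obs 𝒳 =>
      armWeight P Λ a z * (armSign a * (z.2.1 - cutoff P Λ a z.1) * g z.1) :=
    (measurable_armWeight P hΛ a).mul (hφ.comp (f := fun z : Obs 𝒳 => (z.1, z.2.1)) (by fun_prop))
  have hle : ∫ o, armSign a * (arm a o - cutoff P Λ a (X o)) * g (X o) ∂(Q : Measure (Full 𝒳 k)) ≤
      ∫ o, armSign a * (arm a o - cutoff P Λ a (X o)) * g (X o) ∂(Q' : Measure (Full 𝒳 k)) := by
    rw [← m2, ← n2, ← integral_toObs hP hm]
    refine integral_mono_ae ((integrable_toObs_iff hP hm).2 (m1.2 j1)) (n1.2 j2) ?_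
    filter_upwards [hb] with o ⟨_, _, _, ho⟩
    by_cases hA : A o = a
    · obtain ⟨hlow, hup⟩ := ho hA
      have e : armWeight P Λ a (toObs o) = extremalWeight P Λ a (X o) (Y o) := if_pos hA
      have hmul := mul_le_mul_of_nonneg_right (extremalWeight_le P a (X o) (Y o) _ hlow hup)
        (hg01 (X o)).1
      rw [mul_assoc, mul_assoc (ipw Q' a o)] at hmul
      rw [e]
      exact hmul
    · have e : armWeight P Λ a (toObs o) = 0 := if_neg hA
      have e' : ipw Q' a o = 0 := if_neg hA
      rw [e, e', zero_mul, zero_mul]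
  rw [s1, s2] at hle
  linarith

/-- The cutoff need not be integrable, so the policy is truncated to `{|q| ≤ n}` and the truncation
is removed by dominated convergence. -/
theorem IsExtremal.le [StandardBorelSpace 𝒳] {Λ : ℝ} (hΛ : 1 ≤ Λ)
    {P : ProbabilityMeasure (Obs 𝒳)} {Q Q' : ProbabilityMeasure (Full 𝒳 k)}
    (hQ : IsExtremal Λ P Q) (hQ' : Q' ∈ uncertaintySet k Λ P) (a : Bool)
    (hint : Integrable (fun z => maxWeight P Λ a z * z.2.1) (P : Measure (Obs 𝒳)))
    {π : 𝒳 → ℝ} (hπ : π ∈ policies 𝒳) :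
    armSign a * ∫ o, arm a o * π (X o) ∂(Q : Measure (Full 𝒳 k)) ≤
      armSign a * ∫ o, arm a o * π (X o) ∂(Q' : Measure (Full 𝒳 k)) := by
  let D : ℕ → Set 𝒳 := fun n => {x | |cutoff P Λ a x| ≤ n}
  have hD : ∀ n, MeasurableSet (D n) := fun n =>
    measurableSet_le (measurable_cutoff P hΛ a).abs measurable_const
  have hg : ∀ n, Measurable ((D n).indicator π) := fun n => hπ.1.indicator (hD n)
  have hg01 : ∀ n x, (D n).indicator π x ∈ Set.Icc (0 : ℝ) 1 := by
    intro n x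
    by_cases hx : x ∈ D n
    · rw [Set.indicator_of_mem hx]; exact hπ.2 x
    · rw [Set.indicator_of_notMem hx]; simp
  have hlim : ∀ R ∈ uncertaintySet k Λ P,
      Tendsto (fun n => ∫ o, arm a o * (D n).indicator π (X o) ∂(R : Measure (Full 𝒳 k))) atTop
        (𝓝 (∫ o, arm a o * π (X o) ∂(R : Measure (Full 𝒳 k)))) := by
    intro R hR
    refine tendsto_integral_of_dominated_convergence (fun o => ‖arm a o‖)
      (fun n => ((measurable_arm a).mul ((hg n).comp measurable_X)).aestronglyMeasurable)
      (integrable_arm hΛ hR a hint).norm (fun n => ae_of_all _ fun o => ?_)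
      (ae_of_all _ fun o => ?_)
    · rw [norm_mul, Real.norm_of_nonneg (hg01 n _).1]
      exact mul_le_of_le_one_right (norm_nonneg _) (hg01 n _).2
    · refine tendsto_const_nhds.congr' ?_
      obtain ⟨N, hN⟩ := exists_nat_ge |cutoff P Λ a (X o)|
      filter_upwards [eventually_ge_atTop N] with n hn
      have : X o ∈ D n := hN.trans (by exact_mod_cast hn)
      rw [Set.indicator_of_mem this]
  refine le_of_tendsto_of_tendsto' ((hlim Q hQ.mem).const_mul _) ((hlim Q' hQ').const_mul _)
    fun n => hQ.le_of_bounded_cutoff hΛ hQ' a hint (hg n) (hg01 n) (C := n) fun x => ?_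
  by_cases hx : x ∈ D n
  · rw [abs_mul, abs_of_nonneg (hg01 n x).1]
    exact (mul_le_of_le_one_right (abs_nonneg _) (hg01 n x).2).trans hx
  · rw [Set.indicator_of_notMem hx]; simp

/-- The conditional mean of the weighted outcome of arm `a` given the covariates. -/
theorem integral_armWeight_condLawYA (P : ProbabilityMeasure (Obs 𝒳)) (Λ : ℝ) (x : 𝒳) :
    muMinus P Λ x true = ∫ w, armWeight P Λ true (x, w) * w.1 ∂(condLawYA P x) ∧
      muPlus P Λ x false = ∫ w, armWeight P Λ false (x, w) * w.1 ∂(condLawYA P x) := by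
  constructor
  · refine integral_congr_ae (ae_of_all _ fun w => ?_)
    by_cases hw : w.2 = true
    · simp [armWeight, extremalWeight, cutoff, hw, mul_comm]
    · simp [armWeight, hw]
  · refine integral_congr_ae (ae_of_all _ fun w => ?_)
    by_cases hw : w.2 = false
    · simp [armWeight, extremalWeight, cutoff, hw, mul_comm]
    · simp [armWeight, hw]

theorem measurable_tauMinus (P : ProbabilityMeasure (Obs 𝒳)) {Λ : ℝ} (hΛ : 1 ≤ Λ) :
    Measurable (tauMinus P Λ) := by
  have hm : ∀ a, Measurable fun x => ∫ w, armWeight P Λ a (x, w) * w.1 ∂(condLawYA P x) := by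
    intro a
    have : StronglyMeasurable fun p : 𝒳 × ℝ × Bool => armWeight P Λ a p * p.2.1 :=
      ((measurable_armWeight P hΛ a).mul (by fun_prop)).stronglyMeasurable
    exact (this.integral_condDistrib (μ := (P : Measure (Obs 𝒳))) (X := fun z : Obs 𝒳 => z.1)
      (Y := fun z : Obs 𝒳 => z.2)).measurable
  have e : tauMinus P Λ = fun x => ∫ w, armWeight P Λ true (x, w) * w.1 ∂(condLawYA P x) -
      ∫ w, armWeight P Λ false (x, w) * w.1 ∂(condLawYA P x) := by
    ext x
    rw [tauMinus, (integral_armWeight_condLawYA P Λ x).1, (integral_armWeight_condLawYA P Λ x).2]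
  rw [e]
  exact (hm true).sub (hm false)

theorem integral_condLawYA (P : ProbabilityMeasure (Obs 𝒳)) {F : Obs 𝒳 → ℝ}
    (hF : Integrable F (P : Measure (Obs 𝒳))) :
    Integrable (fun z => ∫ w, F (z.1, w) ∂(condLawYA P z.1)) (P : Measure (Obs 𝒳)) ∧
      ∫ z, ∫ w, F (z.1, w) ∂(condLawYA P z.1) ∂(P : Measure (Obs 𝒳)) =
        ∫ z, F z ∂(P : Measure (Obs 𝒳)) := by
  have hid : (P : Measure (Obs 𝒳)).map (fun z => (z.1, z.2)) = P := Measure.map_id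
  have hdis : (P : Measure (Obs 𝒳)).map (fun z : Obs 𝒳 => z.1) ⊗ₘ
      condDistrib (fun z : Obs 𝒳 => z.2) (fun z : Obs 𝒳 => z.1) (P : Measure (Obs 𝒳)) =
      (P : Measure (Obs 𝒳)) :=
    (compProd_map_condDistrib (by fun_prop)).trans hid
  have hF' : Integrable F ((P : Measure (Obs 𝒳)).map fun z => (z.1, z.2)) := by rwa [hid]
  refine ⟨hF'.integral_condDistrib (by fun_prop) (by fun_prop), ?_⟩
  have h1 : ∫ z, F z ∂(P : Measure (Obs 𝒳)) = ∫ z, F z ∂((P : Measure (Obs 𝒳)).map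
      (fun z : Obs 𝒳 => z.1) ⊗ₘ condDistrib (fun z : Obs 𝒳 => z.2) (fun z : Obs 𝒳 => z.1)
        (P : Measure (Obs 𝒳))) := by rw [hdis]
  rw [h1, Measure.integral_compProd (by rwa [hdis]), integral_map (by fun_prop)]
  · rfl
  · exact hF'.1.integral_condDistrib_map (by fun_prop)

/-- Tower property: `π(X)` is constant under the conditional law given `X`, so it factors out of the
two conditional means. -/
theorem IsExtremal.improvement_eq [StandardBorelSpace 𝒳] {Λ : ℝ} (hΛ : 1 ≤ Λ)
    {P : ProbabilityMeasure (Obs 𝒳)} {Q : ProbabilityMeasure (Full 𝒳 k)} (hQ : IsExtremal Λ P Q)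
    (hint : ∀ a, Integrable (fun z => maxWeight P Λ a z * z.2.1) (P : Measure (Obs 𝒳)))
    {π : 𝒳 → ℝ} (hπ : π ∈ policies 𝒳) :
    Integrable (fun z => tauMinus P Λ z.1 * π z.1) (P : Measure (Obs 𝒳)) ∧
      ∫ z, tauMinus P Λ z.1 * π z.1 ∂(P : Measure (Obs 𝒳)) =
        ∫ o, arm true o * π (X o) ∂(Q : Measure (Full 𝒳 k)) -
          ∫ o, arm false o * π (X o) ∂(Q : Measure (Full 𝒳 k)) := by
  have hφ : Measurable fun p : 𝒳 × ℝ => p.2 * π p.1 :=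
    measurable_snd.mul (hπ.1.comp measurable_fst)
  have hF : ∀ a, Integrable (fun z => armWeight P Λ a z * (z.2.1 * π z.1))
      (P : Measure (Obs 𝒳)) := fun a =>
    ((hQ.mean hΛ a hφ).1).2 ((integrable_arm hΛ hQ.mem a (hint a)).mul_bdd (c := 1)
      (hπ.1.comp measurable_X).aestronglyMeasurable (ae_of_all _ fun o => by
        rw [Real.norm_of_nonneg (hπ.2 _).1]; exact (hπ.2 _).2))
  have e : (fun z : Obs 𝒳 => tauMinus P Λ z.1 * π z.1) = fun z =>
      ∫ w, armWeight P Λ true (z.1, w) * (w.1 * π z.1) ∂(condLawYA P z.1) -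
      ∫ w, armWeight P Λ false (z.1, w) * (w.1 * π z.1) ∂(condLawYA P z.1) := by
    ext z
    rw [tauMinus, (integral_armWeight_condLawYA P Λ z.1).1,
      (integral_armWeight_condLawYA P Λ z.1).2, sub_mul, ← integral_mul_const,
      ← integral_mul_const]
    simp only [mul_assoc]
  obtain ⟨i1, e1⟩ := integral_condLawYA P (hF true)
  obtain ⟨i0, e0⟩ := integral_condLawYA P (hF false)
  rw [e, ← (hQ.mean hΛ true hφ).2, ← (hQ.mean hΛ false hφ).2, ← e1, ← e0]
  exact ⟨i1.sub i0, integral_sub i1 i0⟩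

end

end MSM

/-! ### The main theorem. -/

theorem theorem2 {𝒳 : Type*} [MeasurableSpace 𝒳] [StandardBorelSpace 𝒳]
    (k : ℕ) (hk : 1 ≤ k) (Λ : ℝ) (hΛ : 1 ≤ Λ)
    (Pₒ : ProbabilityMeasure (MSM.Full 𝒳 k)) (P : ProbabilityMeasure (MSM.Obs 𝒳))
    (hP : MSM.obsLaw Pₒ = P)
    (hMSM : MSM.IsMSM Λ Pₒ)
    (hY₁ : Integrable MSM.Y₁ (Pₒ : Measure (MSM.Full 𝒳 k)))
    (hY₀ : Integrable MSM.Y₀ (Pₒ : Measure (MSM.Full 𝒳 k)))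
    -- for `Λ > 1`, the conditional law of `Y` has no atom at the two quantiles that enter `τ⁻_Λ`
    (hq₁ : 1 < Λ → ∀ᵐ z ∂(P : Measure (MSM.Obs 𝒳)),
      ¬ (z.2.2 = true ∧ z.2.1 = MSM.qMinus P Λ z.1 true))
    (hq₀ : 1 < Λ → ∀ᵐ z ∂(P : Measure (MSM.Obs 𝒳)),
      ¬ (z.2.2 = false ∧ z.2.1 = MSM.qPlus P Λ z.1 false)) :
    (∀ π ∈ MSM.policies 𝒳,
      (∀ Q ∈ MSM.uncertaintySet k Λ P,
        Integrable (fun o => (MSM.Y₁ o - MSM.Y₀ o) * π (MSM.X o))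
          (Q : Measure (MSM.Full 𝒳 k))) ∧
      Integrable (fun z => MSM.tauMinus P Λ z.1 * π z.1) (P : Measure (MSM.Obs 𝒳)) ∧
      IsGLB ((fun Q => MSM.improvement Q π) '' MSM.uncertaintySet k Λ P)
        (∫ z, MSM.tauMinus P Λ z.1 * π z.1 ∂(P : Measure (MSM.Obs 𝒳))) ∧
      MSM.worstCaseImprovement k Λ P π =
        ∫ z, MSM.tauMinus P Λ z.1 * π z.1 ∂(P : Measure (MSM.Obs 𝒳))) ∧
    MSM.firstBestPolicy P Λ ∈ MSM.policies 𝒳 ∧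
    ∀ π ∈ MSM.policies 𝒳,
      MSM.worstCaseImprovement k Λ P π ≤
        MSM.worstCaseImprovement k Λ P (MSM.firstBestPolicy P Λ) := by
  have hint : ∀ a, Integrable (fun z => maxWeight P Λ a z * z.2.1) (P : Measure (Obs 𝒳)) := by
    intro a
    refine integrable_maxWeight hΛ hP hMSM.latentUnconfounded hMSM.oddsRatioBounded a ?_
    cases a
    · exact hY₀
    · exact hY₁
  obtain ⟨Q₀, hQ₀, hipw⟩ := exists_extremal_law hk hΛ P (overlap hΛ hP hMSM.oddsRatioBounded)
    (fun h a => by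
      cases a
      · exact hq₀ h
      · exact hq₁ h)
  have hext : IsExtremal Λ P Q₀ := ⟨hQ₀, hipw⟩
  have harm : ∀ π ∈ policies 𝒳, ∀ Q ∈ uncertaintySet k Λ P, ∀ a,
      Integrable (fun o => arm a o * π (X o)) (Q : Measure (Full 𝒳 k)) := fun π hπ Q hQ a =>
    (integrable_arm hΛ hQ a (hint a)).mul_bdd (c := 1)
      (hπ.1.comp measurable_X).aestronglyMeasurable (ae_of_all _ fun o => by
        rw [Real.norm_of_nonneg (hπ.2 _).1]; exact (hπ.2 _).2)
  have hdiff : ∀ (π : 𝒳 → ℝ), (fun o : Full 𝒳 k => (Y₁ o - Y₀ o) * π (X o)) =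
      fun o => arm true o * π (X o) - arm false o * π (X o) := fun π => by
    ext o
    rw [← sub_mul]
    rfl
  have himp : ∀ π ∈ policies 𝒳, ∀ Q ∈ uncertaintySet k Λ P, improvement Q π =
      ∫ o, arm true o * π (X o) ∂(Q : Measure (Full 𝒳 k)) -
        ∫ o, arm false o * π (X o) ∂(Q : Measure (Full 𝒳 k)) := fun π hπ Q hQ => by
    rw [improvement, hdiff, integral_sub (harm π hπ Q hQ true) (harm π hπ Q hQ false)]
  -- The same law minimizes the mean of arm 1 and maximizes that of arm 0, so the bounds for the
  -- arms add up to an attained minimum.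
  have hleast : ∀ π ∈ policies 𝒳, IsLeast ((fun Q => improvement Q π) '' uncertaintySet k Λ P)
      (∫ z, tauMinus P Λ z.1 * π z.1 ∂(P : Measure (Obs 𝒳))) := by
    intro π hπ
    rw [(hext.improvement_eq hΛ hint hπ).2]
    refine ⟨⟨Q₀, hQ₀, himp π hπ Q₀ hQ₀⟩, ?_⟩
    rintro _ ⟨Q, hQ, rfl⟩
    have h1 := hext.le hΛ hQ true (hint true) hπ
    have h0 := hext.le hΛ hQ false (hint false) hπ
    simp only [armSign, if_true, Bool.false_eq_true, if_false, one_mul, neg_one_mul,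
      neg_le_neg_iff] at h1 h0
    dsimp only
    rw [himp π hπ Q hQ]
    exact sub_le_sub h1 h0
  have hworst : ∀ π ∈ policies 𝒳, worstCaseImprovement k Λ P π =
      ∫ z, tauMinus P Λ z.1 * π z.1 ∂(P : Measure (Obs 𝒳)) := fun π hπ =>
    (hleast π hπ).csInf_eq
  have hbest : firstBestPolicy P Λ ∈ policies 𝒳 := by
    refine ⟨Measurable.ite (measurableSet_lt measurable_const (measurable_tauMinus P hΛ))
      measurable_const measurable_const, fun x => ?_⟩
    rw [firstBestPolicy]
    split_ifs <;> simp
  refine ⟨fun π hπ => ⟨fun Q hQ => ?_, (hext.improvement_eq hΛ hint hπ).1, (hleast π hπ).isGLB,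
    hworst π hπ⟩, hbest, fun π hπ => ?_⟩
  · rw [hdiff]
    exact (harm π hπ Q hQ true).sub (harm π hπ Q hQ false)
  · rw [hworst π hπ, hworst _ hbest]
    -- Pointwise, `t p ≤ max t 0 = t 1{t > 0}` for `p ∈ [0, 1]`.
    refine integral_mono (hext.improvement_eq hΛ hint hπ).1
      (hext.improvement_eq hΛ hint hbest).1 fun z => ?_
    have h01 := hπ.2 z.1
    dsimp only
    rw [firstBestPolicy]
    split_ifs with h
    · rw [mul_one]; exact mul_le_of_le_one_right h.le h01.2
    · rw [mul_zero]; exact mul_nonpos_of_nonpos_of_nonneg (not_lt.1 h) h01.1
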